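/- Let $d\ge 1$, $R>0$, $h>0$, and let $\pi$ be a probability density on $\mathbb{R}^d$ (with respect to Lebesgue measure) that is positive and continuous on all of $\mathbb{R}^d$. Let $\mathbb{S}^d$ be the unit sphere of $\mathbb{R}^{d+1}$ and let $\mathrm{SP}:\mathbb{S}^d\setminus\{(0,\dots,0,1)\}\to\mathbb{R}^d$, $$\mathrm{SP}(z)=\left(R\frac{z_1}{1-z_{d+1}},\dots,R\frac{z_d}{1-z_{d+1}}\right),$$ be the stereographic projection, whose inverse is given by $z_i=\frac{2Rx_i}{\|x\|^2+R^2}$ for $1\le i\le d$ and $z_{d+1}=\frac{\|x\|^2-R^2}{\|x\|^2+R^2}$. The Stereographic Projection Sampler (SPS) is the Markov chain on $\mathbb{R}^d$ that moves from a state $x$ as follows. Put $z=\mathrm{SP}^{-1}(x)$, draw $w\sim\mathcal{N}(0,h^2I_{d+1})$, and put $$v=w-\frac{(z^Tw)z}{\|z\|^2},\qquad \hat z=\frac{z+v}{\|z+v\|},\qquad \hat X=\mathrm{SP}(\hat z)$$ (which is defined almost surely). The next state is $\hat X$ with probability $$1\wedge\frac{\pi(\hat X)(R^2+\|\hat X\|^2)^d}{\pi(x)(R^2+\|x\|^2)^d},$$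 and otherwise it is $x$. Let $P$ denote the transition kernel of this chain. Then $P$ is a Markov kernel on $\mathbb{R}^d$ that is ergodic with invariant distribution $\pi$: writing $\pi(A)=\int_A\pi(y)\,dy$, we have $\int P(x,A)\,\pi(x)\,dx=\pi(A)$ for every Borel set $A\subseteq\mathbb{R}^d$, and for every starting point $x\in\mathbb{R}^d$, $$\lim_{n\to\infty}\ \sup_{A}\ \left|P^n(x,A)-\pi(A)\right|=0,$$ where the supremum is over all Borel sets $A\subseteq\mathbb{R}^d$. -/

import Mathlib

open MeasureTheory ProbabilityTheory Filter Topology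
open scoped ENNReal

namespace SPS

noncomputable section

/-- Stereographic projection `SP`, from the unit sphere of `ℝ^(d+1)` without its north pole
`(0, …, 0, 1)` to `ℝ^d`. (At the north pole the formula takes the irrelevant value `0`.) -/
def stereo {d : ℕ} (R : ℝ) (z : EuclideanSpace ℝ (Fin (d + 1))) : EuclideanSpace ℝ (Fin d) :=
  WithLp.toLp 2 fun i => R * (z i.castSucc / (1 - z (Fin.last d)))

/-- Inverse stereographic projection `SP⁻¹`, from `ℝ^d` to the unit sphere of `ℝ^(d+1)`. -/
def stereoInv {d : ℕ} (R : ℝ) (x : EuclideanSpace ℝ (Fin d)) : EuclideanSpace ℝ (Fin (d + 1)) :=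
  WithLp.toLp 2 (Fin.snoc (α := fun _ => ℝ) (fun i => 2 * R * x i / (‖x‖ ^ 2 + R ^ 2))
    ((‖x‖ ^ 2 - R ^ 2) / (‖x‖ ^ 2 + R ^ 2)))

/-- The Gaussian distribution `N(0, h² I)` on `ℝ^n`, i.e. the law of `h` times a standard
Gaussian vector. -/
def noise (n : ℕ) (h : ℝ) : Measure (EuclideanSpace ℝ (Fin n)) :=
  (stdGaussian (EuclideanSpace ℝ (Fin n))).map (fun v => h • v)

/-- The increment `w` with its component along `z` removed. -/
def tangentPart {n : ℕ} (z w : EuclideanSpace ℝ (Fin n)) : EuclideanSpace ℝ (Fin n) :=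
  w - (inner ℝ z w / ‖z‖ ^ 2) • z

/-- The point `ẑ = (z + dz) / ‖z + dz‖`, where `dz` is the tangential part of the increment `w`. -/
def sphereMove {n : ℕ} (z w : EuclideanSpace ℝ (Fin n)) : EuclideanSpace ℝ (Fin n) :=
  ‖z + tangentPart z w‖⁻¹ • (z + tangentPart z w)

/-- The proposal `X̂ = SP(ẑ)` from the state `x`, as a function of the Gaussian increment `w`. -/
def proposal {d : ℕ} (R : ℝ) (x : EuclideanSpace ℝ (Fin d))
    (w : EuclideanSpace ℝ (Fin (d + 1))) : EuclideanSpace ℝ (Fin d) :=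
  stereo R (sphereMove (stereoInv R x) w)

/-- The acceptance probability `1 ∧ π(y)(R² + ‖y‖²)^d / (π(x)(R² + ‖x‖²)^d)`. -/
def acceptProb {d : ℕ} (p : EuclideanSpace ℝ (Fin d) → ℝ) (R : ℝ)
    (x y : EuclideanSpace ℝ (Fin d)) : ℝ :=
  min 1 (p y * (R ^ 2 + ‖y‖ ^ 2) ^ d / (p x * (R ^ 2 + ‖x‖ ^ 2) ^ d))

/-- The conditional law of the next state given the current state `x` and the increment `w`:
accept the proposal with probability `acceptProb`, otherwise stay at `x`. -/
def acceptReject {d : ℕ} (p : EuclideanSpace ℝ (Fin d) → ℝ) (R : ℝ)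
    (x : EuclideanSpace ℝ (Fin d)) (w : EuclideanSpace ℝ (Fin (d + 1))) :
    Measure (EuclideanSpace ℝ (Fin d)) :=
  ENNReal.ofReal (acceptProb p R x (proposal R x w)) • Measure.dirac (proposal R x w)
    + (1 - ENNReal.ofReal (acceptProb p R x (proposal R x w))) • Measure.dirac x

theorem measurable_stereo {d : ℕ} (R : ℝ) : Measurable (stereo (d := d) R) := by
  unfold stereo
  fun_prop

theorem measurable_stereoInv {d : ℕ} (R : ℝ) : Measurable (stereoInv (d := d) R) := by
  unfold stereoInv
  refine (WithLp.measurable_toLp 2 _).comp (measurable_pi_iff.2 fun i => ?_)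
  refine Fin.lastCases ?_ (fun j => ?_) i
  · simp only [Fin.snoc_last]
    fun_prop
  · simp only [Fin.snoc_castSucc]
    fun_prop

theorem measurable_proposal {d : ℕ} (R : ℝ) :
    Measurable fun q : EuclideanSpace ℝ (Fin d) × EuclideanSpace ℝ (Fin (d + 1)) =>
      proposal R q.1 q.2 := by
  have h1 : Measurable fun q : EuclideanSpace ℝ (Fin d) × EuclideanSpace ℝ (Fin (d + 1)) =>
      stereoInv R q.1 := (measurable_stereoInv R).comp measurable_fst
  refine (measurable_stereo R).comp ?_
  unfold sphereMove tangentPart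
  fun_prop

theorem measurable_acceptReject {d : ℕ} {p : EuclideanSpace ℝ (Fin d) → ℝ} (hp : Measurable p)
    (R : ℝ) :
    Measurable fun q : EuclideanSpace ℝ (Fin d) × EuclideanSpace ℝ (Fin (d + 1)) =>
      acceptReject p R q.1 q.2 := by
  have h1 := measurable_proposal (d := d) R
  have h2 : Measurable fun q : EuclideanSpace ℝ (Fin d) × EuclideanSpace ℝ (Fin (d + 1)) =>
      ENNReal.ofReal (acceptProb p R q.1 (proposal R q.1 q.2)) := by
    unfold acceptProb
    fun_prop
  refine Measure.measurable_of_measurable_coe _ fun s hs => ?_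
  simp only [acceptReject, Measure.add_apply, Measure.smul_apply, smul_eq_mul]
  have h3 := (Measure.measurable_coe hs).comp (Measure.measurable_dirac.comp h1)
  have h4 : Measurable fun q : EuclideanSpace ℝ (Fin d) × EuclideanSpace ℝ (Fin (d + 1)) =>
      Measure.dirac q.1 s :=
    (Measure.measurable_coe hs).comp (Measure.measurable_dirac.comp measurable_fst)
  exact (h2.mul h3).add ((measurable_const.sub h2).mul h4)

theorem measurable_acceptReject_right {d : ℕ} {p : EuclideanSpace ℝ (Fin d) → ℝ}
    (hp : Measurable p) (R : ℝ) (x : EuclideanSpace ℝ (Fin d)) :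
    Measurable (acceptReject p R x) := by
  have h : Measurable (Function.uncurry (acceptReject p R)) := measurable_acceptReject hp R
  exact h.of_uncurry_left

/-- The transition kernel on `ℝ^d` of the stereographic projection sampler with target density `p`,
radius parameter `R` and step size `h`. -/
def kernel {d : ℕ} {p : EuclideanSpace ℝ (Fin d) → ℝ} (hp : Measurable p) (R h : ℝ) :
    Kernel (EuclideanSpace ℝ (Fin d)) (EuclideanSpace ℝ (Fin d)) where
  toFun x := (noise (d + 1) h).bind (acceptReject p R x)
  measurable' := by
    have : SFinite (noise (d + 1) h) := by unfold noise; infer_instance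
    refine Measure.measurable_of_measurable_coe _ fun s hs => ?_
    have h1 : ∀ x, (noise (d + 1) h).bind (acceptReject p R x) s
        = ∫⁻ w, acceptReject p R x w s ∂(noise (d + 1) h) := fun x =>
      Measure.bind_apply hs (measurable_acceptReject_right hp R x).aemeasurable
    simp only [h1]
    exact ((Measure.measurable_coe hs).comp (measurable_acceptReject hp R)).lintegral_prod_right'

/-- The total variation distance `sup_A |μ(A) - ν(A)|` of two finite measures, the supremum being
over all measurable sets. -/
def tvDist {E : Type*} [MeasurableSpace E] (μ ν : Measure E) : ℝ :=
  ⨆ A : {A : Set E // MeasurableSet A}, |μ.real A - ν.real A|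

/-- The Markov chain with transition kernel `P` is ergodic with invariant distribution `μ`: the
probability measure `μ` is invariant for the Markov kernel `P`, and from every starting point the
law of the chain converges to `μ` in total variation. -/
structure IsErgodicWith {E : Type*} [MeasurableSpace E] (P : Kernel E E) (μ : Measure E) :
    Prop where
  isMarkovKernel : IsMarkovKernel P
  isProbabilityMeasure : IsProbabilityMeasure μ
  invariant : P.Invariant μ
  tendsto_tvDist : ∀ x, Tendsto (fun n : ℕ => tvDist ((P ^ n) x) μ) atTop (𝓝 0)

end

end SPS

/-! The kernel splits as `P(x, ·) = D(x, ·) π + r(x) δ_x` with `D` symmetric. On the sphere the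
proposal has a density, relative to the rotation-invariant measure, depending only on `⟨z, ẑ⟩` and
hence symmetric. Stereographic projection turns the invariant measure into a multiple of `(R² +
‖y‖²)⁻ᵈ dy`, which is exactly what the acceptance ratio corrects for (`kernel_eq`,
`acceptProb_mul_eq`). So `P` is reversible. One move reaches the open hemisphere around `z`, and two
such hemispheres meet unless their centres are antipodal, so the two-step density is positive almost
everywhere (`ae_two_step_pos`).

Convergence is then abstract (`IsErgodicWith.of_density`). `P` acts on `L²(π)` as a self-adjoint
contraction, so `‖Pⁿf‖²` decreases to a limit and the even iterates are Cauchy. The loss `‖g‖² -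
‖Pg‖²` is the mean variance of `g` under `P(u, ·)`; it dominates a weighted integral of `(g x - g
y)²` whose weight is the two-step density. The loss tends to zero along the iterates, so the limit
is constant and `Pⁿf → ∫ f dπ` in `L¹(π)`. To start from a fixed `x`, apply this to `f = D(x, ·)`:
conditioning on the first move makes the distance at time `n + 1` at most `r(x)` times that at time
`n`, plus an error tending to zero, and `r(x) < 1`. -/

namespace SPS

/-! ### Ergodicity of reversible kernels with a density and a rejection atom -/

section Ergodic

variable {E : Type*} [MeasurableSpace E]

/-- A bounded measurable real function. -/
structure BddMeas (f : E → ℝ) : Prop where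
  measurable : Measurable f
  bounded : ∃ M, ∀ x, |f x| ≤ M

namespace BddMeas

variable {f g : E → ℝ}

theorem integrable (hf : BddMeas f) (μ : Measure E) [IsFiniteMeasure μ] : Integrable f μ := by
  obtain ⟨M, hM⟩ := hf.bounded
  exact Integrable.of_bound hf.measurable.aestronglyMeasurable M (ae_of_all _ hM)

theorem const (c : ℝ) : BddMeas fun _ : E => c := ⟨measurable_const, |c|, fun _ => le_rfl⟩

theorem mul (hf : BddMeas f) (hg : BddMeas g) : BddMeas fun x => f x * g x := by
  obtain ⟨M, hM⟩ := hf.bounded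
  obtain ⟨N, hN⟩ := hg.bounded
  refine ⟨hf.measurable.mul hg.measurable, M * N, fun x => ?_⟩
  rw [abs_mul]
  exact mul_le_mul (hM x) (hN x) (abs_nonneg _) ((abs_nonneg _).trans (hM x))

theorem sub (hf : BddMeas f) (hg : BddMeas g) : BddMeas fun x => f x - g x := by
  obtain ⟨M, hM⟩ := hf.bounded
  obtain ⟨N, hN⟩ := hg.bounded
  exact ⟨hf.measurable.sub hg.measurable, M + N, fun x =>
    (abs_sub _ _).trans (add_le_add (hM x) (hN x))⟩

theorem abs (hf : BddMeas f) : BddMeas fun x => |f x| := by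
  obtain ⟨M, hM⟩ := hf.bounded
  exact ⟨hf.measurable.abs, M, fun x => by simpa using hM x⟩

theorem indicator_one {A : Set E} (hA : MeasurableSet A) :
    BddMeas (A.indicator fun _ => (1 : ℝ)) := by
  refine ⟨measurable_const.indicator hA, 1, fun x => ?_⟩
  by_cases h : x ∈ A <;> simp [h]

theorem memLp_two (hf : BddMeas f) (μ : Measure E) [IsFiniteMeasure μ] : MemLp f 2 μ := by
  obtain ⟨M, hM⟩ := hf.bounded
  exact MemLp.of_bound hf.measurable.aestronglyMeasurable M (ae_of_all _ hM)

end BddMeas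

/-- The action of a kernel on functions, `f ↦ (x ↦ ∫ f dP(x, ·))`. -/
noncomputable def avg (P : Kernel E E) (f : E → ℝ) (x : E) : ℝ := ∫ y, f y ∂(P x)

variable {P : Kernel E E} [IsMarkovKernel P] {π : Measure E} [IsProbabilityMeasure π]
  {f g : E → ℝ}

theorem BddMeas.avg (hf : BddMeas f) : BddMeas (SPS.avg P f) := by
  obtain ⟨M, hM⟩ := hf.bounded
  refine ⟨hf.measurable.stronglyMeasurable.integral_kernel.measurable, M, fun x => ?_⟩
  have := norm_integral_le_of_norm_le_const (μ := P x) 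
    (ae_of_all _ fun y => (Real.norm_eq_abs (f y)).trans_le (hM y))
  simpa [SPS.avg] using this

theorem BddMeas.iterate_avg (hf : BddMeas f) (n : ℕ) : BddMeas ((SPS.avg P)^[n] f) := by
  induction n with
  | zero => exact hf
  | succ n ih => rw [Function.iterate_succ_apply']; exact ih.avg

theorem isMarkovKernel_pow (n : ℕ) : IsMarkovKernel (P ^ n) := by
  induction n with
  | zero => rw [pow_zero]; exact inferInstanceAs (IsMarkovKernel Kernel.id)
  | succ n ih => rw [pow_succ]; exact inferInstanceAs (IsMarkovKernel ((P ^ n) ∘ₖ P))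

theorem integral_pow_eq_iterate_avg (hf : BddMeas f) (n : ℕ) (x : E) :
    ∫ y, f y ∂((P ^ n) x) = (avg P)^[n] f x := by
  induction n generalizing x with
  | zero =>
    change ∫ y, f y ∂(Kernel.id x) = _
    rw [Kernel.id_apply, integral_dirac' _ _ hf.measurable.stronglyMeasurable]
    rfl
  | succ n ih =>
    have := isMarkovKernel_pow (P := P) n
    have h1 : P ^ (n + 1) = (P ^ n) ∘ₖ P := pow_succ P n
    rw [h1, Kernel.integral_comp (hf.integrable _), Function.iterate_succ_apply']
    simp only [ih]
    rfl

theorem map_swap_compProd (hrev : P.IsReversible π) :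
    (π ⊗ₘ P).map Prod.swap = π ⊗ₘ P := by
  have : IsFiniteMeasure ((π ⊗ₘ P).map Prod.swap) := inferInstance
  refine Measure.ext_prod fun {s t} hs ht => ?_
  rw [Measure.map_apply measurable_swap (hs.prod ht), Set.preimage_swap_prod,
    Measure.compProd_apply_prod ht hs, Measure.compProd_apply_prod hs ht, hrev ht hs]

/-- Both sides integrate a product against the joint law `π ⊗ₘ P` of two successive states, and
reversibility says that this law is invariant under the swap. -/
theorem integral_mul_avg (hrev : P.IsReversible π) (hf : BddMeas f) (hg : BddMeas g) :
    ∫ x, f x * avg P g x ∂π = ∫ x, avg P f x * g x ∂π := by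
  have key : ∀ {u v : E → ℝ}, BddMeas u → BddMeas v →
      ∫ q, u q.1 * v q.2 ∂(π ⊗ₘ P) = ∫ x, u x * avg P v x ∂π := by
    intro u v hu hv
    have h1 : BddMeas fun q : E × E => u q.1 * v q.2 := by
      refine BddMeas.mul (f := fun q : E × E => u q.1) (g := fun q : E × E => v q.2)
        ⟨hu.measurable.comp measurable_fst, ?_⟩ ⟨hv.measurable.comp measurable_snd, ?_⟩
      · exact hu.bounded.imp fun M hM q => hM q.1
      · exact hv.bounded.imp fun M hM q => hM q.2
    rw [Measure.integral_compProd (h1.integrable _)]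
    simp only [integral_const_mul]
    rfl
  rw [← key hf hg]
  conv_lhs => rw [← map_swap_compProd hrev]
  have hfg : Measurable fun q : E × E => f q.1 * g q.2 :=
    (hf.measurable.comp measurable_fst).mul (hg.measurable.comp measurable_snd)
  rw [integral_map measurable_swap.aemeasurable hfg.aestronglyMeasurable]
  simp only [Prod.fst_swap, Prod.snd_swap]
  simp_rw [mul_comm (f _)]
  rw [key hg hf]
  simp_rw [mul_comm (g _)]

theorem integral_avg (hrev : P.IsReversible π) (hf : BddMeas f) :
    ∫ x, avg P f x ∂π = ∫ x, f x ∂π := by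
  have h := integral_mul_avg hrev hf (BddMeas.const 1)
  simp only [mul_one] at h
  rw [← h]
  simp [avg]

theorem integral_mul_iterate_avg (hrev : P.IsReversible π) (hf : BddMeas f) (hg : BddMeas g)
    (n : ℕ) : ∫ x, f x * (avg P)^[n] g x ∂π = ∫ x, (avg P)^[n] f x * g x ∂π := by
  induction n generalizing f with
  | zero => rfl
  | succ n ih =>
    rw [Function.iterate_succ_apply', integral_mul_avg hrev hf (hg.iterate_avg n), ih hf.avg,
      Function.iterate_succ_apply]

theorem integral_iterate_avg (hrev : P.IsReversible π) (hf : BddMeas f) (n : ℕ) :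
    ∫ x, (avg P)^[n] f x ∂π = ∫ x, f x ∂π := by
  induction n with
  | zero => rfl
  | succ n ih => rw [Function.iterate_succ_apply', integral_avg hrev (hf.iterate_avg n), ih]

/-- Jensen's inequality under `P x`, followed by invariance. This monotonicity later upgrades
convergence along a subsequence to full convergence. -/
theorem integral_abs_avg_sub_le (hrev : P.IsReversible π) (hf : BddMeas f) (c : ℝ) :
    ∫ x, |avg P f x - c| ∂π ≤ ∫ x, |f x - c| ∂π := by
  rw [← integral_avg hrev (hf.sub (BddMeas.const c)).abs]
  refine integral_mono ((hf.avg.sub (BddMeas.const c)).abs.integrable π)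
    ((hf.sub (BddMeas.const c)).abs.avg.integrable π) fun x => ?_
  have h : avg P f x - c = ∫ y, (f y - c) ∂(P x) := by
    rw [integral_sub (hf.integrable _) (integrable_const _)]
    simp [avg]
  simp only [h]
  exact abs_integral_le_integral_abs

/-- Two independent copies differ in mean square by twice the variance. -/
theorem lintegral_lintegral_sq_sub (μ : Measure E) [IsProbabilityMeasure μ] (hg : BddMeas g) :
    ∫⁻ x, ∫⁻ y, ENNReal.ofReal ((g x - g y) ^ 2) ∂μ ∂μ
      = ENNReal.ofReal (2 * (∫ x, g x ^ 2 ∂μ - (∫ x, g x ∂μ) ^ 2)) := by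
  have hi := hg.integrable μ
  have hi2 : Integrable (fun x => g x ^ 2) μ := by simpa only [sq] using (hg.mul hg).integrable μ
  have h1 : ∀ x, Integrable (fun y => (g x - g y) ^ 2) μ := fun x => by
    simpa only [sq] using
      (((BddMeas.const (g x)).sub hg).mul ((BddMeas.const (g x)).sub hg)).integrable μ
  have h2 : ∀ x, ∫ y, (g x - g y) ^ 2 ∂μ
      = g x ^ 2 - 2 * (∫ y, g y ∂μ) * g x + ∫ y, g y ^ 2 ∂μ := fun x => by
    have : ∀ y, (g x - g y) ^ 2 = g x ^ 2 - 2 * g x * g y + g y ^ 2 := fun y => by ring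
    simp only [this]
    rw [integral_add (by fun_prop) hi2, integral_sub (by fun_prop) (by fun_prop),
      integral_const_mul]
    simp
    ring
  have h3 : ∀ x, ∫⁻ y, ENNReal.ofReal ((g x - g y) ^ 2) ∂μ
      = ENNReal.ofReal (∫ y, (g x - g y) ^ 2 ∂μ) := fun x =>
    (ofReal_integral_eq_lintegral_ofReal (h1 x) (ae_of_all _ fun y => sq_nonneg _)).symm
  simp only [h3]
  rw [← ofReal_integral_eq_lintegral_ofReal]
  · congr 1
    simp only [h2]
    rw [integral_add (by fun_prop) (by fun_prop), integral_sub (by fun_prop) (by fun_prop),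
      integral_const_mul]
    simp
    ring
  · simp only [h2]
    fun_prop
  · exact ae_of_all _ fun x => integral_nonneg fun y => sq_nonneg _

theorem sq_avg_le (hg : BddMeas g) (u : E) : avg P g u ^ 2 ≤ avg P (fun x => g x ^ 2) u := by
  have hi := hg.integrable (P u)
  have hi2 : Integrable (fun x => g x ^ 2) (P u) := by
    simpa only [sq] using (hg.mul hg).integrable (P u)
  have h0 : 0 ≤ ∫ y, (g y - avg P g u) ^ 2 ∂(P u) := integral_nonneg fun y => sq_nonneg _
  have h1 : ∀ y, (g y - avg P g u) ^ 2 = g y ^ 2 - 2 * avg P g u * g y + avg P g u ^ 2 :=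
    fun y => by ring
  simp only [h1] at h0
  rw [integral_add (by fun_prop) (by fun_prop), integral_sub (by fun_prop) (by fun_prop),
    integral_const_mul] at h0
  simp only [integral_const, probReal_univ, smul_eq_mul, one_mul] at h0
  change 0 ≤ avg P (fun x => g x ^ 2) u - 2 * avg P g u * avg P g u + _ at h0
  nlinarith

/-- By invariance, the right side is the `π`-average over `u` of twice the variance of `g` under `P
u`. Write the variance with two independent draws from `P u` and discard all but the part `D u` of
each draw. -/
theorem lintegral_sq_sub_mul_le (hrev : P.IsReversible π) {D : E → E → ℝ≥0∞}
    (hD : Measurable (Function.uncurry D)) (hDP : ∀ x, π.withDensity (D x) ≤ P x)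
    (hg : BddMeas g) :
    ∫⁻ q : E × E, ENNReal.ofReal ((g q.1 - g q.2) ^ 2) * ∫⁻ u, D u q.1 * D u q.2 ∂π ∂(π.prod π)
      ≤ ENNReal.ofReal (2 * (∫ x, g x ^ 2 ∂π - ∫ x, avg P g x ^ 2 ∂π)) := by
  have hgm := hg.measurable
  have hsq : BddMeas fun x => g x ^ 2 := by simpa only [sq] using hg.mul hg
  have hsq' : BddMeas fun x => avg P g x ^ 2 := by simpa only [sq] using hg.avg.mul hg.avg
  have hm : Measurable fun r : (E × E) × E => ENNReal.ofReal ((g r.1.1 - g r.1.2) ^ 2) *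
      (D r.2 r.1.1 * D r.2 r.1.2) := by
    have h1 : Measurable fun r : (E × E) × E => D r.2 r.1.1 :=
      hD.comp (f := fun r : (E × E) × E => (r.2, r.1.1)) (by fun_prop)
    have h2 : Measurable fun r : (E × E) × E => D r.2 r.1.2 :=
      hD.comp (f := fun r : (E × E) × E => (r.2, r.1.2)) (by fun_prop)
    fun_prop
  have hDu : ∀ u, Measurable (D u) := fun u => hD.of_uncurry_left
  calc ∫⁻ q : E × E, ENNReal.ofReal ((g q.1 - g q.2) ^ 2) * ∫⁻ u, D u q.1 * D u q.2 ∂π ∂(π.prod π)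
      = ∫⁻ q : E × E, ∫⁻ u, ENNReal.ofReal ((g q.1 - g q.2) ^ 2) * (D u q.1 * D u q.2) ∂π
          ∂(π.prod π) := by
        simp_rw [lintegral_const_mul' _ _ ENNReal.ofReal_ne_top]
    _ = ∫⁻ u, ∫⁻ q : E × E, ENNReal.ofReal ((g q.1 - g q.2) ^ 2) * (D u q.1 * D u q.2)
          ∂(π.prod π) ∂π := lintegral_lintegral_swap hm.aemeasurable
    _ ≤ ∫⁻ u, ∫⁻ x, ∫⁻ y, ENNReal.ofReal ((g x - g y) ^ 2) ∂(P u) ∂(P u) ∂π := by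
        refine lintegral_mono fun u => ?_
        have hmu : Measurable fun q : E × E => ENNReal.ofReal ((g q.1 - g q.2) ^ 2) *
            (D u q.1 * D u q.2) :=
          hm.comp (f := fun q : E × E => (q, u)) (by fun_prop)
        rw [lintegral_prod _ hmu.aemeasurable]
        calc ∫⁻ x, ∫⁻ y, ENNReal.ofReal ((g x - g y) ^ 2) * (D u x * D u y) ∂π ∂π
            = ∫⁻ x, D u x * ∫⁻ y, D u y * ENNReal.ofReal ((g x - g y) ^ 2) ∂π ∂π := by
              refine lintegral_congr fun x => ?_
              rw [← lintegral_const_mul _ (by have := hDu u; fun_prop)]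
              refine lintegral_congr fun y => ?_
              ring
          _ = ∫⁻ x, ∫⁻ y, ENNReal.ofReal ((g x - g y) ^ 2) ∂(π.withDensity (D u))
                ∂(π.withDensity (D u)) := by
              rw [lintegral_withDensity_eq_lintegral_mul _ (hDu u)]
              · refine lintegral_congr fun x => ?_
                rw [Pi.mul_apply, lintegral_withDensity_eq_lintegral_mul _ (hDu u) (by fun_prop)]
                rfl
              · exact Measurable.lintegral_prod_right' (f := fun q : E × E =>
                  ENNReal.ofReal ((g q.1 - g q.2) ^ 2)) (by fun_prop)
          _ ≤ _ := lintegral_mono' (hDP u) fun x => lintegral_mono' (hDP u) le_rfl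
    _ = ∫⁻ u, ENNReal.ofReal (2 * (avg P (fun x => g x ^ 2) u - avg P g u ^ 2)) ∂π :=
        lintegral_congr fun u => lintegral_lintegral_sq_sub (P u) hg
    _ = ENNReal.ofReal (2 * (∫ x, g x ^ 2 ∂π - ∫ x, avg P g x ^ 2 ∂π)) := by
        rw [← ofReal_integral_eq_lintegral_ofReal, integral_const_mul,
          integral_sub (hsq.avg.integrable _) (hsq'.integrable _), integral_avg hrev hsq]
        · exact ((hsq.avg.integrable _).sub (hsq'.integrable _)).const_mul 2
        · refine ae_of_all _ fun u => ?_
          have := sq_avg_le (P := P) hg u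
          simp only [Pi.zero_apply]
          linarith

theorem integral_iterate_avg_mul_iterate_avg (hrev : P.IsReversible π) (hf : BddMeas f)
    {m n k : ℕ} (h : m + n = 2 * k) :
    ∫ x, (avg P)^[m] f x * (avg P)^[n] f x ∂π = ∫ x, (avg P)^[k] f x ^ 2 ∂π := by
  have key : ∀ m n : ℕ, ∫ x, (avg P)^[m] f x * (avg P)^[n] f x ∂π
      = ∫ x, f x * (avg P)^[m + n] f x ∂π := fun m n => by
    rw [Function.iterate_add_apply, integral_mul_iterate_avg hrev hf (hf.iterate_avg n)]
  simp only [sq, key, h, two_mul]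

theorem antitone_integral_sq_iterate_avg (hrev : P.IsReversible π) (hf : BddMeas f) :
    Antitone fun n => ∫ x, (avg P)^[n] f x ^ 2 ∂π := by
  refine antitone_nat_of_succ_le fun n => ?_
  have hg := hf.iterate_avg (P := P) n
  have hsq : BddMeas fun x => (avg P)^[n] f x ^ 2 := by simpa only [sq] using hg.mul hg
  have hsq' : BddMeas fun x => avg P ((avg P)^[n] f) x ^ 2 := by
    simpa only [sq] using hg.avg.mul hg.avg
  rw [← integral_avg hrev hsq]
  simp only [Function.iterate_succ_apply']
  exact integral_mono (hsq'.integrable π) (hsq.avg.integrable π) fun u => sq_avg_le hg u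

theorem exists_tendsto_integral_sq_iterate_avg (hrev : P.IsReversible π) (hf : BddMeas f) :
    ∃ ℓ, Tendsto (fun n => ∫ x, (avg P)^[n] f x ^ 2 ∂π) atTop (𝓝 ℓ) :=
  ⟨_, tendsto_atTop_ciInf (antitone_integral_sq_iterate_avg hrev hf)
    ⟨0, by rintro _ ⟨n, rfl⟩; exact integral_nonneg fun x => sq_nonneg _⟩⟩

/-- Self-adjointness gives `⟨P^(2m) f, P^(2n) f⟩ = ‖P^(m+n) f‖²`, so distances between even iterates
are controlled by the convergent sequence `‖Pⁿf‖²`. Odd gaps are avoided because a spectral value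
`-1` is not yet excluded. -/
theorem exists_ae_tendsto_iterate_avg (hrev : P.IsReversible π) (hf : BddMeas f) :
    ∃ (G : E → ℝ) (ns : ℕ → ℕ), Tendsto ns atTop atTop ∧
      ∀ᵐ x ∂π, Tendsto (fun k => (avg P)^[ns k] f x) atTop (𝓝 (G x)) := by
  obtain ⟨ℓ, hℓ⟩ := exists_tendsto_integral_sq_iterate_avg hrev hf
  set a : ℕ → ℝ := fun n => ∫ x, (avg P)^[n] f x ^ 2 ∂π with ha
  have hmem : ∀ n, MemLp ((avg P)^[2 * n] f) 2 π := fun n => (hf.iterate_avg _).memLp_two π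
  set F : ℕ → Lp ℝ 2 π := fun n => (hmem n).toLp _ with hF
  have hdist : ∀ m n, ‖F m - F n‖ ^ 2 = a (2 * m) + a (2 * n) - 2 * a (m + n) := fun m n => by
    have hinner : ∀ m n, inner ℝ (F m) (F n) = a (m + n) := fun m n => by
      rw [L2.inner_def, ha]
      simp only
      rw [← integral_iterate_avg_mul_iterate_avg hrev hf (m := 2 * m) (n := 2 * n) (by ring)]
      refine integral_congr_ae ?_
      filter_upwards [(hmem m).coeFn_toLp, (hmem n).coeFn_toLp] with x hm hn
      simp only [hF, hm, hn]
      simp [mul_comm]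
    rw [norm_sub_sq_real, ← real_inner_self_eq_norm_sq, ← real_inner_self_eq_norm_sq,
      hinner, hinner, hinner, ← two_mul, ← two_mul]
    ring
  have hcauchy : CauchySeq F := by
    rw [Metric.cauchySeq_iff']
    intro ε hε
    -- In `a (2n) + a (2N) - 2 a (n+N)` the limits cancel and the deviations carry total weight `4`.
    obtain ⟨N, hN⟩ := Metric.tendsto_atTop.1 hℓ (ε ^ 2 / 4) (by positivity)
    refine ⟨N, fun n hn => ?_⟩
    rw [dist_eq_norm]
    have h1 := abs_lt.1 (Real.dist_eq _ _ ▸ hN (2 * n) (by omega))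
    have h2 := abs_lt.1 (Real.dist_eq _ _ ▸ hN (2 * N) (by omega))
    have h3 := abs_lt.1 (Real.dist_eq _ _ ▸ hN (n + N) (by omega))
    have h4 := hdist n N
    refine lt_of_pow_lt_pow_left₀ 2 hε.le ?_
    linarith
  obtain ⟨G, hG⟩ := cauchySeq_tendsto_of_complete hcauchy
  obtain ⟨ns, hns, hlim⟩ := (tendstoInMeasure_of_tendsto_Lp hG).exists_seq_tendsto_ae
  refine ⟨G, fun k => 2 * ns k, ?_, ?_⟩
  · exact tendsto_atTop_mono (fun k => by omega) hns.tendsto_atTop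
  · have hae : ∀ᵐ x ∂π, ∀ n, F n x = (avg P)^[2 * n] f x :=
      ae_all_iff.2 fun n => (hmem n).coeFn_toLp
    filter_upwards [hlim, hae] with x hx hx'
    simpa only [hx'] using hx

/-- The energy lost in one step tends to zero, so a subsequential limit `G` has no variation between
points where the weight `W` is positive, that is, almost everywhere. -/
theorem tendsto_integral_abs_iterate_avg_sub (hrev : P.IsReversible π) {D : E → E → ℝ≥0∞}
    (hD : Measurable (Function.uncurry D)) (hDP : ∀ x, π.withDensity (D x) ≤ P x)
    (hpos : ∀ᵐ q ∂(π.prod π), ∫⁻ u, D u q.1 * D u q.2 ∂π ≠ 0) (hf : BddMeas f) :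
    Tendsto (fun n => ∫ x, |(avg P)^[n] f x - ∫ y, f y ∂π| ∂π) atTop (𝓝 0) := by
  obtain ⟨G, ns, hns, hlim⟩ := exists_ae_tendsto_iterate_avg hrev hf
  obtain ⟨ℓ, hℓ⟩ := exists_tendsto_integral_sq_iterate_avg hrev hf
  set W : E × E → ℝ≥0∞ := fun q => ∫⁻ u, D u q.1 * D u q.2 ∂π with hW
  have hWm : Measurable W := by
    have h1 : Measurable fun r : (E × E) × E => D r.2 r.1.1 :=
      hD.comp (f := fun r : (E × E) × E => (r.2, r.1.1)) (by fun_prop)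
    have h2 : Measurable fun r : (E × E) × E => D r.2 r.1.2 :=
      hD.comp (f := fun r : (E × E) × E => (r.2, r.1.2)) (by fun_prop)
    exact (h1.mul h2).lintegral_prod_right'
  set H : ℕ → E × E → ℝ≥0∞ := fun k q =>
    ENNReal.ofReal (((avg P)^[ns k] f q.1 - (avg P)^[ns k] f q.2) ^ 2) * W q with hH
  have hHm : ∀ k, Measurable (H k) := fun k => by
    have := (hf.iterate_avg (P := P) (ns k)).measurable
    fun_prop
  have hH0 : Tendsto (fun k => ∫⁻ q, H k q ∂(π.prod π)) atTop (𝓝 0) := by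
    have hb : ∀ k, ∫⁻ q, H k q ∂(π.prod π) ≤ ENNReal.ofReal (2 * (∫ x, (avg P)^[ns k] f x ^ 2 ∂π
        - ∫ x, (avg P)^[ns k + 1] f x ^ 2 ∂π)) := fun k => by
      simp only [Function.iterate_succ_apply']
      exact lintegral_sq_sub_mul_le hrev hD hDP (hf.iterate_avg _)
    refine tendsto_of_tendsto_of_tendsto_of_le_of_le tendsto_const_nhds ?_ (fun _ => zero_le) hb
    have h1 := (((hℓ.comp hns).sub
      (hℓ.comp ((tendsto_add_atTop_nat 1).comp hns))).const_mul 2)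
    have h2 := ENNReal.tendsto_ofReal h1
    simpa using h2
  have hae : ∀ᵐ q ∂(π.prod π), G q.1 = G q.2 := by
    -- Fatou transfers the vanishing energy loss to the limit: `(G x - G y)² W(x, y) = 0` almost
    -- everywhere.
    have hfatou : ∫⁻ q, liminf (fun k => H k q) atTop ∂(π.prod π) = 0 :=
      le_antisymm ((lintegral_liminf_le hHm).trans hH0.liminf_eq.le) zero_le
    rw [lintegral_eq_zero_iff (Measurable.liminf hHm)] at hfatou
    have l1 := (Measure.quasiMeasurePreserving_fst (μ := π) (ν := π)).ae hlim
    have l2 := (Measure.quasiMeasurePreserving_snd (μ := π) (ν := π)).ae hlim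
    filter_upwards [hfatou, l1, l2, hpos] with q hq h1 h2 hWq
    by_contra hne
    have hne' : G q.1 - G q.2 ≠ 0 := sub_ne_zero.2 hne
    have h3 := ENNReal.tendsto_ofReal ((h1.sub h2).pow 2)
    have h4 : ENNReal.ofReal ((G q.1 - G q.2) ^ 2) ≠ 0 := by
      rw [Ne, ENNReal.ofReal_eq_zero, not_le]; positivity
    have h5 := (ENNReal.Tendsto.mul_const h3 (Or.inl h4) (b := W q)).liminf_eq
    exact (mul_ne_zero h4 hWq) (h5.symm.trans hq)
  -- Freezing one generic coordinate shows that `G` is almost everywhere the constant `G x₀`.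
  obtain ⟨x₀, hx₀⟩ := (Measure.ae_ae_of_ae_prod hae).exists
  have hlim' : ∀ᵐ x ∂π, Tendsto (fun k => (avg P)^[ns k] f x) atTop (𝓝 (G x₀)) := by
    filter_upwards [hlim, hx₀] with x hx hx'
    rwa [hx']
  obtain ⟨M, hM⟩ := hf.bounded
  have hMk : ∀ k x, ‖(avg P)^[k] f x‖ ≤ M := fun k => by
    induction k with
    | zero => exact hM
    | succ k ih =>
      intro x
      rw [Function.iterate_succ_apply']
      simpa [avg] using norm_integral_le_of_norm_le_const (μ := P x) (ae_of_all _ ih)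
  have hc : ∫ y, f y ∂π = G x₀ := by
    have h1 := tendsto_integral_of_dominated_convergence (μ := π) (fun _ => M)
      (fun k => (hf.iterate_avg (P := P) (ns k)).measurable.aestronglyMeasurable)
      (integrable_const M) (fun k => ae_of_all _ (hMk (ns k))) hlim'
    simp only [integral_iterate_avg hrev hf, integral_const, probReal_univ, one_smul] at h1
    exact tendsto_nhds_unique tendsto_const_nhds h1
  rw [hc]
  have hsub : Tendsto (fun k => ∫ x, |(avg P)^[ns k] f x - G x₀| ∂π) atTop (𝓝 0) := by
    have h1 := tendsto_integral_of_dominated_convergence (μ := π) (fun _ => M + |G x₀|)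
      (F := fun k x => |(avg P)^[ns k] f x - G x₀|) (f := fun _ => 0)
      (fun k => ((hf.iterate_avg (P := P) (ns k)).sub
        (BddMeas.const _)).abs.measurable.aestronglyMeasurable)
      (integrable_const _) (fun k => ae_of_all _ fun x => ?_) ?_
    · simpa using h1
    · rw [Real.norm_eq_abs, abs_abs]
      exact (abs_sub _ _).trans (add_le_add_left (hMk _ x) _)
    · filter_upwards [hlim'] with x hx
      simpa using (hx.sub_const (G x₀)).abs
  have hanti : Antitone fun n => ∫ x, |(avg P)^[n] f x - G x₀| ∂π := by
    refine antitone_nat_of_succ_le fun n => ?_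
    simp only [Function.iterate_succ_apply']
    exact integral_abs_avg_sub_le hrev (hf.iterate_avg n) _
  exact tendsto_iff_tendsto_subseq_of_antitone hanti hns |>.2 hsub

/-- A recursive inequality `u (n + 1) ≤ r u n + ε n` with `r < 1` and `ε → 0` forces `u → 0`. -/
theorem tendsto_zero_of_le_mul_add {u ε : ℕ → ℝ} {r : ℝ} (hr0 : 0 ≤ r) (hr : r < 1)
    (hu : ∀ n, 0 ≤ u n) (h : ∀ n, u (n + 1) ≤ r * u n + ε n) (hε : Tendsto ε atTop (𝓝 0)) :
    Tendsto u atTop (𝓝 0) := by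
  rw [Metric.tendsto_atTop]
  intro η hη
  have hr' : 0 < 1 - r := sub_pos.2 hr
  -- This size makes `η / 2` the fixed point of `u ↦ r u + η / 2 * (1 - r)`, so the excess over `η /
  -- 2` contracts by `r` at each step.
  obtain ⟨N, hN⟩ := Metric.tendsto_atTop.1 hε (η / 2 * (1 - r)) (by positivity)
  have h1 : ∀ k, u (N + k) - η / 2 ≤ r ^ k * u N := fun k => by
    induction k with
    | zero => simp; positivity
    | succ k ih =>
      have h2 := (abs_lt.1 (Real.dist_eq _ _ ▸ hN (N + k) (by omega))).2
      have h3 := h (N + k)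
      have h4 := mul_le_mul_of_nonneg_left ih hr0
      rw [pow_succ, ← add_assoc]
      linarith
  obtain ⟨K, hK⟩ := Metric.tendsto_atTop.1
    ((tendsto_pow_atTop_nhds_zero_of_lt_one hr0 hr).mul_const (u N)) (η / 2) (by positivity)
  refine ⟨N + K, fun n hn => ?_⟩
  obtain ⟨k, rfl⟩ := Nat.exists_eq_add_of_le (le_of_add_le_left hn)
  have h2 := (abs_lt.1 (Real.dist_eq _ _ ▸ hK k (by omega))).2
  rw [Real.dist_eq, sub_zero, abs_of_nonneg (hu _)]
  linarith [h1 k]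

/-- A reversible Markov kernel of the form `P(x, ·) = D(x, ·) π + r(x) δ_x`, with `D(x, ·)` bounded
and with a positive two-step density, is ergodic with invariant distribution `π`. -/
theorem IsErgodicWith.of_density {D : E → E → ℝ≥0∞} {r : E → ℝ≥0∞}
    (hD : Measurable (Function.uncurry D)) (hsymm : ∀ x y, D x y = D y x)
    (hP : ∀ x, P x = π.withDensity (D x) + r x • Measure.dirac x)
    (hbdd : ∀ x, ∃ M : ℝ, ∀ y, D x y ≤ ENNReal.ofReal M)
    (hpos : ∀ x, ∀ᵐ y ∂π, ∫⁻ u, D x u * D u y ∂π ≠ 0) :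
    IsErgodicWith P π := by
  have hDx : ∀ x, Measurable (D x) := fun x => hD.of_uncurry_left
  have hDP : ∀ x, π.withDensity (D x) ≤ P x := fun x => by
    rw [hP x]; exact Measure.le_add_right le_rfl
  have hr1 : ∀ x, ∫⁻ y, D x y ∂π + r x = 1 := fun x => by
    have h := measure_univ (μ := P x)
    rw [hP x] at h
    simpa using h
  -- The density part is symmetric by `hsymm`; the atom contributes the integral of `r` over `A ∩
  -- B`, symmetric in `A` and `B`.
  have hrev : P.IsReversible π := by
    intro A B hA hB
    have h1 : ∀ {A B : Set E}, MeasurableSet A → MeasurableSet B → ∫⁻ x in A, P x B ∂π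
        = ∫⁻ x in A, ∫⁻ y in B, D x y ∂π ∂π + ∫⁻ x in B ∩ A, r x ∂π := fun {A B} hA hB => by
      have h2 : ∀ x, P x B = ∫⁻ y in B, D x y ∂π + B.indicator r x := fun x => by
        rw [hP x, Measure.add_apply, withDensity_apply _ hB, Measure.smul_apply,
          Measure.dirac_apply' _ hB]
        by_cases hx : x ∈ B <;> simp [hx]
      simp only [h2]
      have h3 : Measurable fun x => ∫⁻ y in B, D x y ∂π := hD.lintegral_prod_right'
      rw [lintegral_add_left h3, lintegral_indicator hB,
        Measure.restrict_restrict hB]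
    rw [h1 hA hB, h1 hB hA, Set.inter_comm B A, lintegral_lintegral_swap hD.aemeasurable]
    simp only [hsymm]
  have hpos' : ∀ᵐ q ∂(π.prod π), ∫⁻ u, D u q.1 * D u q.2 ∂π ≠ 0 := by
    have h1 : Measurable fun s : (E × E) × E => D s.2 s.1.1 :=
      hD.comp (f := fun s : (E × E) × E => (s.2, s.1.1)) (by fun_prop)
    have h2 : Measurable fun s : (E × E) × E => D s.2 s.1.2 :=
      hD.comp (f := fun s : (E × E) × E => (s.2, s.1.2)) (by fun_prop)
    have h3 : Measurable fun q : E × E => ∫⁻ u, D u q.1 * D u q.2 ∂π :=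
      (h1.mul h2).lintegral_prod_right'
    refine (Measure.ae_prod_mem_iff_ae_ae_mem (h3 (measurableSet_singleton 0).compl)).2 ?_
    refine ae_of_all _ fun x => ?_
    filter_upwards [hpos x] with y hy
    simp only [hsymm x] at hy
    exact hy
  refine ⟨inferInstance, inferInstance, hrev.invariant, fun x => ?_⟩
  obtain ⟨M, hM⟩ := hbdd x
  set φ : E → ℝ := fun y => (D x y).toReal with hφ
  have hφb : BddMeas φ := ⟨(hDx x).ennreal_toReal, max M 0, fun y => by
    rw [abs_of_nonneg ENNReal.toReal_nonneg]
    exact (ENNReal.toReal_mono ENNReal.ofReal_ne_top (hM y)).trans_eq ENNReal.toReal_ofReal'⟩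
  have hr0 : (r x) ≠ ⊤ := fun h => by simpa [h] using hr1 x
  have hφi : ∫ y, φ y ∂π = 1 - (r x).toReal := by
    rw [hφ, integral_toReal (hDx x).aemeasurable
      (ae_of_all _ fun y => (hM y).trans_lt ENNReal.ofReal_lt_top)]
    have h := congrArg ENNReal.toReal (hr1 x)
    rw [ENNReal.toReal_add (fun h => by simpa [h] using hr1 x) hr0, ENNReal.toReal_one] at h
    linarith
  -- If `r x = 1`, then `D x` vanishes almost everywhere and the two-step density from `x` is zero.
  have hrlt : (r x).toReal < 1 := by
    obtain ⟨y, hy⟩ := (hpos x).exists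
    have h0 : 0 ≤ ∫ y, φ y ∂π := integral_nonneg fun _ => ENNReal.toReal_nonneg
    refine lt_of_le_of_ne (by linarith) fun h => hy ?_
    rw [h, sub_self, integral_eq_zero_iff_of_nonneg (fun _ => ENNReal.toReal_nonneg)
      (hφb.integrable π)] at hφi
    rw [← lintegral_zero (μ := π)]
    refine lintegral_congr_ae ?_
    filter_upwards [hφi] with u hu
    have : D x u = 0 := (ENNReal.toReal_eq_zero_iff _).1 hu |>.resolve_right
      ((hM u).trans_lt ENNReal.ofReal_lt_top).ne
    simp [this]
  -- Condition on the first move and shift the remaining `n` steps from the indicator of `A` onto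
  -- `φ`, so that the error can be bounded uniformly in `A`. The centring is consistent because `φ`
  -- has mass `1 - r x`.
  have hstep : ∀ (n : ℕ) (A : Set E), MeasurableSet A →
      ((P ^ (n + 1)) x).real A - π.real A = ∫ y, A.indicator (fun _ => (1 : ℝ)) y *
        ((avg P)^[n] φ y - ∫ z, φ z ∂π) ∂π
        + (r x).toReal * (((P ^ n) x).real A - π.real A) := by
    intro n A hA
    have hone := BddMeas.indicator_one hA
    have h1 : ∀ k, ((P ^ k) x).real A = (avg P)^[k] (A.indicator fun _ => (1 : ℝ)) x := fun k => by
      rw [← integral_pow_eq_iterate_avg hone k x]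
      exact (integral_indicator_one hA).symm
    have h2 : π.real A = ∫ y, A.indicator (fun _ => (1 : ℝ)) y ∂π :=
      (integral_indicator_one hA).symm
    set g := (avg P)^[n] (A.indicator fun _ => (1 : ℝ)) with hg
    have hgb : BddMeas g := hone.iterate_avg n
    have h3 : avg P g x = ∫ y, φ y * g y ∂π + (r x).toReal * g x := by
      have hint := hgb.integrable (P x)
      rw [avg]
      rw [hP x] at hint ⊢
      rw [integral_add_measure hint.left_of_add_measure hint.right_of_add_measure,
        integral_smul_measure, integral_dirac' _ _ hgb.measurable.stronglyMeasurable,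
        integral_withDensity_eq_integral_toReal_smul (hDx x)
          (ae_of_all _ fun y => (hM y).trans_lt ENNReal.ofReal_lt_top)]
      simp [hφ]
    rw [h1, h1, Function.iterate_succ_apply', h3, hg, integral_mul_iterate_avg hrev hφb hone]
    simp only [mul_sub]
    rw [integral_sub ((hone.mul (hφb.iterate_avg n)).integrable π)
      ((hone.integrable π).mul_const _), integral_mul_const, ← h2, hφi]
    simp only [mul_comm ((avg P)^[n] φ _)]
    ring
  -- An unbounded real supremum is `0` by convention, so boundedness is needed before any term can
  -- be compared with `tvDist`.
  have hbound : ∀ n, BddAbove (Set.range fun A : {A : Set E // MeasurableSet A} =>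
      |((P ^ n) x).real A - π.real A|) := by
    intro n
    have := isMarkovKernel_pow (P := P) n
    refine ⟨1, ?_⟩
    rintro _ ⟨A, rfl⟩
    have h1 := measureReal_le_one (μ := (P ^ n) x) (s := (A : Set E))
    have h2 := measureReal_le_one (μ := π) (s := (A : Set E))
    have h3 := measureReal_nonneg (μ := (P ^ n) x) (s := (A : Set E))
    have h4 := measureReal_nonneg (μ := π) (s := (A : Set E))
    exact abs_le.2 ⟨by linarith, by linarith⟩
  refine tendsto_zero_of_le_mul_add ENNReal.toReal_nonneg hrlt
    (fun n => Real.iSup_nonneg fun _ => abs_nonneg _) (fun n => ?_)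
    (tendsto_integral_abs_iterate_avg_sub hrev hD hDP hpos' hφb)
  have : Nonempty {A : Set E // MeasurableSet A} := ⟨⟨∅, .empty⟩⟩
  refine ciSup_le fun A => ?_
  rw [hstep n A A.2, add_comm]
  refine (abs_add_le _ _).trans (add_le_add ?_ ?_)
  · rw [abs_mul, abs_of_nonneg ENNReal.toReal_nonneg]
    exact mul_le_mul_of_nonneg_left (le_ciSup (hbound n) A) ENNReal.toReal_nonneg
  · refine abs_integral_le_integral_abs.trans ?_
    have hψ := (hφb.iterate_avg (P := P) n).sub (BddMeas.const (∫ z, φ z ∂π))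
    refine integral_mono (((BddMeas.indicator_one A.2).mul hψ).abs.integrable π)
      (hψ.abs.integrable π) fun y => ?_
    by_cases hy : y ∈ (A : Set E) <;> simp [hy]

end Ergodic

/-! ### Splitting off the last coordinate; Lebesgue and Gaussian integrals -/

section Coordinates

variable {d : ℕ}

/-- The point `(x, t)` of `ℝ^(d+1)`. -/
noncomputable def snoc (x : EuclideanSpace ℝ (Fin d)) (t : ℝ) : EuclideanSpace ℝ (Fin (d + 1)) :=
  WithLp.toLp 2 (Fin.snoc (α := fun _ => ℝ) (fun i => x i) t)

@[simp] theorem snoc_castSucc (x : EuclideanSpace ℝ (Fin d)) (t : ℝ) (i : Fin d) :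
    snoc x t i.castSucc = x i := by simp [snoc]

@[simp] theorem snoc_last (x : EuclideanSpace ℝ (Fin d)) (t : ℝ) :
    snoc x t (Fin.last d) = t := by simp [snoc]

theorem ext_snoc {y z : EuclideanSpace ℝ (Fin (d + 1))}
    (h : ∀ i : Fin d, y i.castSucc = z i.castSucc) (hl : y (Fin.last d) = z (Fin.last d)) :
    y = z := by
  ext i
  exact Fin.lastCases hl h i

theorem smul_snoc (c : ℝ) (x : EuclideanSpace ℝ (Fin d)) (t : ℝ) :
    c • snoc x t = snoc (c • x) (c * t) :=
  ext_snoc (fun i => by simp) (by simp)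

theorem inner_snoc_snoc (x y : EuclideanSpace ℝ (Fin d)) (s t : ℝ) :
    inner ℝ (snoc x s) (snoc y t) = inner ℝ x y + s * t := by
  simp only [PiLp.inner_apply, Fin.sum_univ_castSucc, snoc_castSucc, snoc_last]
  simp [mul_comm]

theorem norm_snoc_sq (x : EuclideanSpace ℝ (Fin d)) (t : ℝ) :
    ‖snoc x t‖ ^ 2 = ‖x‖ ^ 2 + t ^ 2 := by
  rw [← real_inner_self_eq_norm_sq, inner_snoc_snoc, real_inner_self_eq_norm_sq, sq t]

theorem norm_snoc (x : EuclideanSpace ℝ (Fin d)) (t : ℝ) :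
    ‖snoc x t‖ = √(‖x‖ ^ 2 + t ^ 2) := by
  rw [← norm_snoc_sq, Real.sqrt_sq (norm_nonneg _)]

theorem measurable_snoc :
    Measurable fun q : EuclideanSpace ℝ (Fin d) × ℝ => snoc q.1 q.2 := by
  unfold snoc
  refine (WithLp.measurable_toLp 2 _).comp (measurable_pi_iff.2 fun i => ?_)
  refine Fin.lastCases ?_ (fun j => ?_) i
  · simp only [Fin.snoc_last]
    fun_prop
  · simp only [Fin.snoc_castSucc]
    fun_prop

@[fun_prop] theorem _root_.Measurable.snoc {α : Type*} [MeasurableSpace α]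
    {f : α → EuclideanSpace ℝ (Fin d)} {g : α → ℝ} (hf : Measurable f) (hg : Measurable g) :
    Measurable fun a => SPS.snoc (f a) (g a) :=
  measurable_snoc.comp (hf.prodMk hg)

theorem lintegral_pi_snoc (μ : Measure ℝ) [SigmaFinite μ]
    {F : EuclideanSpace ℝ (Fin (d + 1)) → ℝ≥0∞} (hF : Measurable F) :
    ∫⁻ y, F y ∂((Measure.pi fun _ : Fin (d + 1) => μ).map (WithLp.toLp 2))
      = ∫⁻ t, ∫⁻ x, F (snoc x t) ∂((Measure.pi fun _ : Fin d => μ).map (WithLp.toLp 2)) ∂μ := by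
  rw [lintegral_map hF (WithLp.measurable_toLp 2 _)]
  have h := (measurePreserving_piFinSuccAbove (fun _ : Fin (d + 1) => μ) (Fin.last d)).symm
  rw [← h.lintegral_comp (by fun_prop), lintegral_prod _ (by fun_prop)]
  refine lintegral_congr fun t => ?_
  rw [lintegral_map (by fun_prop) (WithLp.measurable_toLp 2 _)]
  refine lintegral_congr fun x => ?_
  congr 1
  refine ext_snoc (fun i => ?_) ?_
  · simp [MeasurableEquiv.piFinSuccAbove, Fin.insertNthEquiv, Fin.insertNth_last', snoc]
  · simp [MeasurableEquiv.piFinSuccAbove, Fin.insertNthEquiv, Fin.insertNth_last', snoc]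

theorem lintegral_volume_snoc {F : EuclideanSpace ℝ (Fin (d + 1)) → ℝ≥0∞} (hF : Measurable F) :
    ∫⁻ y, F y = ∫⁻ t, ∫⁻ x, F (snoc x t) := by
  have h := lintegral_pi_snoc volume hF
  simp only [← volume_pi, (PiLp.volume_preserving_toLp _).map_eq] at h
  exact h

theorem lintegral_stdGaussian_snoc {F : EuclideanSpace ℝ (Fin (d + 1)) → ℝ≥0∞}
    (hF : Measurable F) :
    ∫⁻ y, F y ∂(stdGaussian (EuclideanSpace ℝ (Fin (d + 1))))
      = ∫⁻ t, ∫⁻ x, F (snoc x t) ∂(stdGaussian (EuclideanSpace ℝ (Fin d))) ∂(gaussianReal 0 1) := by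
  simpa only [map_pi_eq_stdGaussian] using lintegral_pi_snoc (gaussianReal 0 1) hF

theorem lintegral_comp_smul {F : EuclideanSpace ℝ (Fin d) → ℝ≥0∞} (hF : Measurable F) {c : ℝ}
    (hc : 0 < c) : ∫⁻ x, F x = ENNReal.ofReal (c ^ d) * ∫⁻ x, F (c • x) := by
  have h := Measure.map_addHaar_smul (volume : Measure (EuclideanSpace ℝ (Fin d))) hc.ne'
  rw [← lintegral_map hF (measurable_const_smul c), h, lintegral_smul_measure, smul_eq_mul,
    ← mul_assoc, ← ENNReal.ofReal_mul (by positivity), finrank_euclideanSpace, Fintype.card_fin,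
    abs_of_pos (by positivity), mul_inv_cancel₀ (by positivity), ENNReal.ofReal_one, one_mul]

theorem pi_gaussianReal_eq_withDensity :
    (Measure.pi fun _ : Fin d => gaussianReal 0 1)
      = (volume : Measure (Fin d → ℝ)).withDensity
          fun x => ENNReal.ofReal (∏ i, gaussianPDFReal 0 1 (x i)) := by
  refine Measure.pi_eq fun s hs => ?_
  have hind : ∀ x : Fin d → ℝ, (Set.univ.pi s).indicator
      (fun x => ENNReal.ofReal (∏ i, gaussianPDFReal 0 1 (x i))) x
      = ENNReal.ofReal (∏ i, (s i).indicator (gaussianPDFReal 0 1) (x i)) := fun x => by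
    by_cases hx : x ∈ Set.univ.pi s
    · rw [Set.indicator_of_mem hx]
      congr 1
      exact Finset.prod_congr rfl fun i _ => by
        rw [Set.indicator_of_mem (hx i (Set.mem_univ i))]
    · rw [Set.indicator_of_notMem hx]
      simp only [Set.mem_pi, Set.mem_univ, true_implies, not_forall] at hx
      obtain ⟨i, hi⟩ := hx
      rw [Finset.prod_eq_zero (Finset.mem_univ i) (Set.indicator_of_notMem hi _),
        ENNReal.ofReal_zero]
  have hint : ∀ i, Integrable ((s i).indicator (gaussianPDFReal 0 1)) := fun i =>
    (integrable_gaussianPDFReal 0 1).indicator (hs i)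
  have hnn : ∀ i x, 0 ≤ (s i).indicator (gaussianPDFReal 0 1) x := fun i x =>
    Set.indicator_nonneg (fun _ _ => gaussianPDFReal_nonneg _ _ _) x
  have hms : MeasurableSet (Set.univ.pi s) := MeasurableSet.univ_pi hs
  rw [withDensity_apply _ hms, ← lintegral_indicator hms]
  simp only [hind]
  rw [← ofReal_integral_eq_lintegral_ofReal, volume_pi, integral_fintype_prod_eq_prod,
    ENNReal.ofReal_prod_of_nonneg]
  · refine Finset.prod_congr rfl fun i _ => ?_
    rw [gaussianReal_of_var_ne_zero _ one_ne_zero, withDensity_apply _ (hs i),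
      ← lintegral_indicator (hs i), ofReal_integral_eq_lintegral_ofReal (hint i)
      (ae_of_all _ (hnn i))]
    refine lintegral_congr fun x => ?_
    by_cases hx : x ∈ s i <;> simp [hx, gaussianPDF]
  · exact fun i _ => integral_nonneg (hnn i)
  · exact Integrable.fintype_prod hint
  · exact ae_of_all _ fun x => Finset.prod_nonneg fun i _ => hnn i _

theorem lintegral_stdGaussian {F : EuclideanSpace ℝ (Fin d) → ℝ≥0∞} (hF : Measurable F) :
    ∫⁻ x, F x ∂(stdGaussian (EuclideanSpace ℝ (Fin d)))
      = ENNReal.ofReal ((√(2 * Real.pi))⁻¹ ^ d) *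
        ∫⁻ x, ENNReal.ofReal (Real.exp (-‖x‖ ^ 2 / 2)) * F x := by
  have hF' : Measurable fun x : EuclideanSpace ℝ (Fin d) =>
      ENNReal.ofReal (Real.exp (-‖x‖ ^ 2 / 2)) * F x := by fun_prop
  rw [← map_pi_eq_stdGaussian, lintegral_map hF (WithLp.measurable_toLp 2 _),
    pi_gaussianReal_eq_withDensity, lintegral_withDensity_eq_lintegral_mul _ (by fun_prop)
    (by fun_prop), ← (PiLp.volume_preserving_toLp (Fin d)).lintegral_comp hF',
    ← lintegral_const_mul _ (by fun_prop)]
  refine lintegral_congr fun x => ?_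
  rw [Pi.mul_apply, ← mul_assoc, ← ENNReal.ofReal_mul (by positivity)]
  congr 2
  simp only [gaussianPDFReal, Finset.prod_mul_distrib, ← Real.exp_sum]
  simp [EuclideanSpace.norm_sq_eq, Finset.sum_div, neg_div, Finset.sum_neg_distrib]

end Coordinates

open scoped Nat

/-! ### The law of the proposal on the sphere -/

section Sphere

variable {d : ℕ}

theorem lintegral_pow_mul_exp_neg {A : ℝ} (hA : 0 < A) :
    ∫⁻ t in Set.Ioi (0 : ℝ), ENNReal.ofReal (t ^ d) * ENNReal.ofReal (Real.exp (-(t * A)))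
      = ENNReal.ofReal (d ! / A ^ (d + 1)) := by
  have h := Real.integral_rpow_mul_exp_neg_mul_Ioi (a := d + 1) (r := A) (by positivity) hA
  have h1 : ∫ t in Set.Ioi (0 : ℝ), t ^ d * Real.exp (-(t * A)) = d ! / A ^ (d + 1) := by
    rw [Real.Gamma_nat_eq_factorial] at h
    simp only [add_sub_cancel_right, Real.rpow_natCast] at h
    simp only [mul_comm _ A]
    rw [h, ← Nat.cast_succ, Real.rpow_natCast, one_div, inv_pow, ← div_eq_inv_mul]
  have hint : Integrable (fun t => t ^ d * Real.exp (-(t * A)))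
      (volume.restrict (Set.Ioi (0 : ℝ))) := by
    -- The integral of a non-integrable function is `0` by convention, so the nonzero value found in
    -- `h1` forces integrability.
    refine not_imp_comm.1 integral_undef ?_
    rw [h1]
    positivity
  rw [← h1, ofReal_integral_eq_lintegral_ofReal hint]
  · refine setLIntegral_congr_fun measurableSet_Ioi fun t ht => ?_
    exact (ENNReal.ofReal_mul (pow_nonneg (le_of_lt ht) d)).symm
  · filter_upwards [ae_restrict_mem measurableSet_Ioi] with t ht
    have : 0 < t := ht
    positivity

/-- The radial projection onto the unit sphere. -/
noncomputable def radial {n : ℕ} (y : EuclideanSpace ℝ (Fin n)) : EuclideanSpace ℝ (Fin n) :=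
  ‖y‖⁻¹ • y

@[fun_prop] theorem measurable_radial {n : ℕ} : Measurable (radial (n := n)) := by
  unfold radial
  fun_prop

theorem radial_smul {n : ℕ} {c : ℝ} (hc : 0 < c) (y : EuclideanSpace ℝ (Fin n)) :
    radial (c • y) = radial y := by
  rw [radial, radial, norm_smul, Real.norm_of_nonneg hc.le, smul_smul, mul_inv, mul_comm c⁻¹,
    mul_assoc, inv_mul_cancel₀ hc.ne', mul_one]

theorem norm_snoc_one_pos (v : EuclideanSpace ℝ (Fin d)) : 0 < ‖snoc v 1‖ := by
  rw [norm_snoc]; positivity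

/-- Central projection of a hemisphere onto its tangent space at the pole. -/
theorem lintegral_hemisphere {H : EuclideanSpace ℝ (Fin (d + 1)) → ℝ≥0∞} (hH : Measurable H)
    (h0 : ∀ u, u (Fin.last d) ≤ 0 → H u = 0) :
    ∫⁻ y, H (radial y) * ENNReal.ofReal (Real.exp (-‖y‖))
      = ∫⁻ v : EuclideanSpace ℝ (Fin d), H (radial (snoc v 1)) *
          ENNReal.ofReal (d ! / ‖snoc v 1‖ ^ (d + 1)) := by
  rw [lintegral_volume_snoc (by fun_prop)]
  have hneg : ∀ t : ℝ, t ≤ 0 → ∀ x : EuclideanSpace ℝ (Fin d), H (radial (snoc x t)) = 0 :=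
    fun t ht x => h0 _ <| by
      simp only [radial, PiLp.smul_apply, snoc_last, smul_eq_mul]
      exact mul_nonpos_of_nonneg_of_nonpos (by positivity) ht
  rw [← setLIntegral_eq_of_support_subset (s := Set.Ioi 0)]
  · calc ∫⁻ t in Set.Ioi (0 : ℝ), ∫⁻ x : EuclideanSpace ℝ (Fin d),
          H (radial (snoc x t)) * ENNReal.ofReal (Real.exp (-‖snoc x t‖))
        = ∫⁻ t in Set.Ioi (0 : ℝ), ∫⁻ v : EuclideanSpace ℝ (Fin d), H (radial (snoc v 1)) *
            (ENNReal.ofReal (t ^ d) * ENNReal.ofReal (Real.exp (-(t * ‖snoc v 1‖)))) := by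
          refine setLIntegral_congr_fun measurableSet_Ioi fun t ht => ?_
          have ht : 0 < t := ht
          -- At height `t` substitute `x = t v`: the Jacobian is `t ^ d` and the direction depends
          -- on `v` alone, leaving a Gamma integral in `t`.
          rw [lintegral_comp_smul (by fun_prop) ht, ← lintegral_const_mul _ (by fun_prop)]
          refine lintegral_congr fun v => ?_
          have : snoc (t • v) t = t • snoc v 1 := by rw [smul_snoc, mul_one]
          rw [this, radial_smul ht, norm_smul, Real.norm_of_nonneg ht.le]
          ring
      _ = ∫⁻ v : EuclideanSpace ℝ (Fin d), ∫⁻ t in Set.Ioi (0 : ℝ), H (radial (snoc v 1)) *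
            (ENNReal.ofReal (t ^ d) * ENNReal.ofReal (Real.exp (-(t * ‖snoc v 1‖)))) :=
          lintegral_lintegral_swap (by unfold Function.uncurry; fun_prop)
      _ = _ := by
          refine lintegral_congr fun v => ?_
          rw [lintegral_const_mul _ (by fun_prop), lintegral_pow_mul_exp_neg (norm_snoc_one_pos v)]
  · intro t ht
    by_contra h
    exact ht (by simp [hneg t (not_lt.1 h)])

/-- The density of the proposal on the sphere, as a function of the inner product. -/
noncomputable def sphereDensity (d : ℕ) (h t : ℝ) : ℝ :=
  if 0 < t then (t ^ (d + 1))⁻¹ * Real.exp (-((t ^ 2)⁻¹ - 1) / (2 * h ^ 2)) else 0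

@[fun_prop] theorem measurable_sphereDensity (d : ℕ) (h : ℝ) : Measurable (sphereDensity d h) := by
  unfold sphereDensity
  exact Measurable.ite measurableSet_Ioi (by fun_prop) (by fun_prop)

/-- The normalising constant of the proposal density. -/
noncomputable def sphereConst (d : ℕ) (h : ℝ) : ℝ := (√(2 * Real.pi) ^ d * h ^ d * d !)⁻¹

theorem lintegral_noise_eq {n : ℕ} {h : ℝ} {F : EuclideanSpace ℝ (Fin n) → ℝ≥0∞}
    (hF : Measurable F) :
    ∫⁻ w, F w ∂(noise n h) = ∫⁻ w, F (h • w) ∂(stdGaussian (EuclideanSpace ℝ (Fin n))) :=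
  lintegral_map hF (measurable_const_smul h)

theorem measurable_sphereMove {n : ℕ} (z : EuclideanSpace ℝ (Fin n)) :
    Measurable (sphereMove z) := by
  unfold sphereMove tangentPart
  fun_prop

/-- At the pole, `z + v` is `(h x, 1)` with `x` standard Gaussian, so the move is a central
projection. The inner product with the pole is `t = ‖(h x, 1)‖⁻¹`, whence `h² ‖x‖² = t⁻² - 1` in the
Gaussian exponent, while `t⁻⁽ᵈ⁺¹⁾` cancels the Jacobian of `lintegral_hemisphere`. Weighting `y` by
`exp (-‖y‖)` stands in for surface measure. -/
theorem lintegral_sphereMove_pole {h : ℝ} (hh : 0 < h)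
    {F : EuclideanSpace ℝ (Fin (d + 1)) → ℝ≥0∞} (hF : Measurable F) :
    ∫⁻ w, F (sphereMove (snoc 0 1) w) ∂(noise (d + 1) h)
      = ENNReal.ofReal (sphereConst d h) * ∫⁻ y, F (radial y) *
          ENNReal.ofReal (sphereDensity d h (inner ℝ (snoc 0 1) (radial y))) *
          ENNReal.ofReal (Real.exp (-‖y‖)) := by
  have hm := measurable_sphereMove (snoc (0 : EuclideanSpace ℝ (Fin d)) 1)
  have h1 : ∀ (x : EuclideanSpace ℝ (Fin d)) (t : ℝ),
      sphereMove (snoc 0 1) (h • snoc x t) = radial (snoc (h • x) 1) := fun x t => by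
    have hn : ‖snoc (0 : EuclideanSpace ℝ (Fin d)) 1‖ ^ 2 = 1 := by simp [norm_snoc_sq]
    have : snoc 0 1 + tangentPart (snoc 0 1) (h • snoc x t) = snoc (h • x) 1 := by
      rw [tangentPart, hn, smul_snoc, inner_snoc_snoc]
      exact ext_snoc (fun i => by simp) (by simp)
    rw [sphereMove, this, radial]
  have hFm : Measurable fun w => F (sphereMove (snoc (0 : EuclideanSpace ℝ (Fin d)) 1) w) :=
    hF.comp hm
  rw [lintegral_noise_eq hFm, lintegral_stdGaussian_snoc (by fun_prop)]
  simp only [h1, lintegral_const, measure_univ, mul_one]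
  rw [lintegral_stdGaussian (by fun_prop),
    lintegral_hemisphere
      (H := fun u => F u * ENNReal.ofReal (sphereDensity d h (inner ℝ (snoc 0 1) u)))
      (by fun_prop) fun u hu => ?_]
  · rw [lintegral_comp_smul (c := h) (F := fun v => F (radial (snoc v 1)) * ENNReal.ofReal
      (sphereDensity d h (inner ℝ (snoc 0 1) (radial (snoc v 1)))) *
          ENNReal.ofReal (d ! / ‖snoc v 1‖ ^ (d + 1))) (by fun_prop) hh,
      ← lintegral_const_mul _ (by fun_prop), ← lintegral_const_mul _ (by fun_prop),
      ← lintegral_const_mul _ (by fun_prop)]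
    refine lintegral_congr fun v => ?_
    have hA := norm_snoc_one_pos (h • v)
    have hA2 : ‖snoc (h • v) 1‖ ^ 2 = h ^ 2 * ‖v‖ ^ 2 + 1 := by
      rw [norm_snoc_sq, norm_smul, Real.norm_of_nonneg hh.le]; ring
    have hin : inner ℝ (snoc 0 1) (radial (snoc (h • v) 1)) = ‖snoc (h • v) 1‖⁻¹ := by
      rw [radial, real_inner_smul_right, inner_snoc_snoc]; simp
    rw [hin, sphereDensity, if_pos (inv_pos.2 hA)]
    simp only [inv_pow, inv_inv, hA2]
    have he : -(h ^ 2 * ‖v‖ ^ 2 + 1 - 1) / (2 * h ^ 2) = -‖v‖ ^ 2 / 2 := by field_simp; ring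
    rw [he]
    set A := ‖snoc (h • v) 1‖
    have hr : ∀ a b c e k : ℝ≥0∞, a * (b * (c * e * k)) = a * b * e * k * c :=
      fun a b c e k => by ring
    have hC : 0 ≤ sphereConst d h := by unfold sphereConst; positivity
    rw [hr, ← mul_assoc, ← ENNReal.ofReal_mul (by positivity), ← ENNReal.ofReal_mul hC,
      ← ENNReal.ofReal_mul (by positivity), ← ENNReal.ofReal_mul (by positivity)]
    congr 2
    rw [sphereConst]
    field_simp
  · have : inner ℝ (snoc 0 1) u ≤ 0 := by
      have h2 : u = snoc (WithLp.toLp 2 fun i => u i.castSucc) (u (Fin.last d)) :=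
        ext_snoc (fun i => by simp) (by simp)
      rw [h2, inner_snoc_snoc]
      simpa using hu
    simp [sphereDensity, not_lt.2 this]

theorem map_radial {n : ℕ} (Φ : EuclideanSpace ℝ (Fin n) ≃ₗᵢ[ℝ] EuclideanSpace ℝ (Fin n))
    (y : EuclideanSpace ℝ (Fin n)) : Φ (radial y) = radial (Φ y) := by
  simp [radial]

theorem map_sphereMove {n : ℕ} (Φ : EuclideanSpace ℝ (Fin n) ≃ₗᵢ[ℝ] EuclideanSpace ℝ (Fin n))
    (z w : EuclideanSpace ℝ (Fin n)) : Φ (sphereMove z w) = sphereMove (Φ z) (Φ w) := by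
  have h : Φ (z + tangentPart z w) = Φ z + tangentPart (Φ z) (Φ w) := by
    simp [tangentPart]
  rw [sphereMove, sphereMove, ← h, map_smul, Φ.norm_map]

theorem map_noise {n : ℕ} (Φ : EuclideanSpace ℝ (Fin n) ≃ₗᵢ[ℝ] EuclideanSpace ℝ (Fin n)) (h : ℝ) :
    (noise n h).map Φ = noise n h := by
  have hΦ : Measurable Φ := Φ.continuous.measurable
  conv_rhs => rw [noise, ← stdGaussian_map Φ, Measure.map_map (measurable_const_smul h) hΦ]
  rw [noise, Measure.map_map hΦ (measurable_const_smul h)]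
  congr 1
  ext w
  simp

/-- The law of the proposal on the sphere, expressed through the law of the radial projection. -/
theorem lintegral_sphereMove {h : ℝ} (hh : 0 < h) {z : EuclideanSpace ℝ (Fin (d + 1))}
    (hz : ‖z‖ = 1) {F : EuclideanSpace ℝ (Fin (d + 1)) → ℝ≥0∞} (hF : Measurable F) :
    ∫⁻ w, F (sphereMove z w) ∂(noise (d + 1) h)
      = ENNReal.ofReal (sphereConst d h) * ∫⁻ y, F (radial y) *
          ENNReal.ofReal (sphereDensity d h (inner ℝ z (radial y))) *
          ENNReal.ofReal (Real.exp (-‖y‖)) := by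
  have he : ‖snoc (0 : EuclideanSpace ℝ (Fin d)) 1‖ = 1 := by simp [norm_snoc]
  -- The reflection exchanging the pole and `z`; noise, move and reference weight are all invariant
  -- under it.
  let Φ : EuclideanSpace ℝ (Fin (d + 1)) ≃ₗᵢ[ℝ] EuclideanSpace ℝ (Fin (d + 1)) :=
    (ℝ ∙ (snoc 0 1 - z))ᗮ.reflection
  have hΦe : Φ (snoc 0 1) = z := Submodule.reflection_sub (by rw [he, hz])
  have hΦ : Measurable Φ := Φ.continuous.measurable
  rw [← hΦe]
  have hFm : Measurable fun w => F (sphereMove (Φ (snoc 0 1)) w) :=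
    hF.comp (measurable_sphereMove _)
  conv_lhs => rw [← map_noise Φ h, lintegral_map hFm hΦ]
  simp only [← map_sphereMove]
  have hFΦ : Measurable fun u => F (Φ u) := hF.comp hΦ
  rw [lintegral_sphereMove_pole hh hFΦ]
  congr 1
  conv_rhs => rw [← Φ.measurePreserving.lintegral_comp (by fun_prop)]
  refine lintegral_congr fun y => ?_
  rw [← map_radial, Φ.inner_map_map, Φ.norm_map]

end Sphere

/-! ### Stereographic projection of the rotation-invariant measure -/

section Stereographic

variable {d : ℕ}

/-- The substitution is `ρ = √(b² + t²) - t`. With `b = ‖x‖` this is `‖y‖ - y_{d+1}` at `y = (x,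
t)`, which is the denominator of the stereographic projection scaled by `‖y‖`. -/
theorem lintegral_real_eq_lintegral_Ioi {b : ℝ} (hb : 0 < b) (g : ℝ → ℝ≥0∞) :
    ∫⁻ t, g t = ∫⁻ ρ in Set.Ioi (0 : ℝ),
      ENNReal.ofReal ((b ^ 2 / ρ ^ 2 + 1) / 2) * g ((b ^ 2 / ρ - ρ) / 2) := by
  have hderiv : ∀ ρ ∈ Set.Ioi (0 : ℝ), HasDerivWithinAt (fun ρ => (b ^ 2 / ρ - ρ) / 2)
      (-((b ^ 2 / ρ ^ 2 + 1) / 2)) (Set.Ioi 0) ρ := fun ρ hρ => by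
    have hρ0 : ρ ≠ 0 := (show 0 < ρ from hρ).ne'
    have h := ((((hasDerivAt_inv hρ0).const_mul (b ^ 2)).sub (hasDerivAt_id ρ)).div_const
      2).hasDerivWithinAt (s := Set.Ioi 0)
    refine (h.congr_deriv (by ring)).congr_of_mem (fun σ _ => ?_) hρ
    simp [div_eq_mul_inv]
  have hinj : Set.InjOn (fun ρ : ℝ => (b ^ 2 / ρ - ρ) / 2) (Set.Ioi 0) := by
    intro ρ hρ σ hσ h
    have hρ : 0 < ρ := hρ
    have hσ : 0 < σ := hσ
    simp only at h
    field_simp at h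
    have h2 : (σ - ρ) * (b ^ 2 + ρ * σ) = 0 := by linear_combination h
    rcases mul_eq_zero.1 h2 with h3 | h3
    · linarith
    · nlinarith [mul_pos hρ hσ, sq_nonneg b]
  have himage : (fun ρ : ℝ => (b ^ 2 / ρ - ρ) / 2) '' Set.Ioi 0 = Set.univ := by
    refine Set.eq_univ_of_forall fun t => ?_
    have hs : √(b ^ 2 + t ^ 2) ^ 2 = b ^ 2 + t ^ 2 := Real.sq_sqrt (by positivity)
    have hlt : t < √(b ^ 2 + t ^ 2) :=
      Real.lt_sqrt_of_sq_lt (by nlinarith [sq_pos_of_pos hb])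
    have hpos : 0 < √(b ^ 2 + t ^ 2) - t := sub_pos.2 hlt
    refine ⟨√(b ^ 2 + t ^ 2) - t, hpos, ?_⟩
    simp only
    field_simp
    linear_combination -hs
  have h := lintegral_image_eq_lintegral_abs_deriv_mul measurableSet_Ioi hderiv hinj g
  rw [himage, Measure.restrict_univ] at h
  rw [h]
  refine lintegral_congr fun ρ => ?_
  rw [abs_neg, abs_of_nonneg (by positivity)]

theorem stereoInv_eq_snoc (R : ℝ) (x : EuclideanSpace ℝ (Fin d)) :
    stereoInv R x = snoc ((2 * R / (‖x‖ ^ 2 + R ^ 2)) • x)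
      ((‖x‖ ^ 2 - R ^ 2) / (‖x‖ ^ 2 + R ^ 2)) := by
  refine ext_snoc (fun i => ?_) ?_
  · simp [stereoInv]
    ring
  · simp [stereoInv]

theorem norm_stereoInv {R : ℝ} (hR : 0 < R) (x : EuclideanSpace ℝ (Fin d)) :
    ‖stereoInv R x‖ = 1 := by
  have h : 0 < ‖x‖ ^ 2 + R ^ 2 := by positivity
  rw [stereoInv_eq_snoc, norm_snoc, norm_smul, Real.norm_of_nonneg (by positivity)]
  rw [Real.sqrt_eq_one]
  field_simp
  ring

theorem stereo_stereoInv {R : ℝ} (hR : 0 < R) (x : EuclideanSpace ℝ (Fin d)) :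
    stereo R (stereoInv R x) = x := by
  have h : 0 < ‖x‖ ^ 2 + R ^ 2 := by positivity
  have h1 : 1 - (‖x‖ ^ 2 - R ^ 2) / (‖x‖ ^ 2 + R ^ 2) = 2 * R ^ 2 / (‖x‖ ^ 2 + R ^ 2) := by
    field_simp
    ring
  ext i
  simp only [stereo, stereoInv_eq_snoc, snoc_castSucc, snoc_last, h1, PiLp.smul_apply, smul_eq_mul]
  field_simp

/-- The push-forward of the uniform distribution on the sphere by the stereographic projection has
density proportional to `(R² + ‖x‖²)⁻ᵈ`. -/
theorem lintegral_radial_eq_lintegral_stereoInv (hd : 1 ≤ d) {R : ℝ} (hR : 0 < R)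
    {G : EuclideanSpace ℝ (Fin (d + 1)) → ℝ≥0∞} (hG : Measurable G) :
    ∫⁻ y, G (radial y) * ENNReal.ofReal (Real.exp (-‖y‖))
      = ENNReal.ofReal (d ! * (2 * R) ^ d) * ∫⁻ x : EuclideanSpace ℝ (Fin d),
          G (stereoInv R x) * ENNReal.ofReal (((R ^ 2 + ‖x‖ ^ 2) ^ d)⁻¹) := by
  have : Nonempty (Fin d) := ⟨⟨0, hd⟩⟩
  have hsi := measurable_stereoInv (d := d) R
  rw [lintegral_volume_snoc (by fun_prop),
    lintegral_lintegral_swap (by unfold Function.uncurry; fun_prop)]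
  set a : EuclideanSpace ℝ (Fin d) → ℝ := fun x => (‖x‖ ^ 2 + R ^ 2) / (2 * R ^ 2) with ha
  have ha0 : ∀ x, 0 < a x := fun x => by positivity
  -- In the coordinates `(ρ, x)`, fixing `x` traces the ray through `stereoInv R x`, at radius `ρ *
  -- a x`.
  have hpt : ∀ (ρ : ℝ), ρ ≠ 0 → ∀ x : EuclideanSpace ℝ (Fin d),
      snoc ((ρ / R) • x) ((‖(ρ / R) • x‖ ^ 2 / ρ - ρ) / 2) = (ρ * a x) • stereoInv R x := by
    intro ρ hρ x
    have h : 0 < ‖x‖ ^ 2 + R ^ 2 := by positivity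
    rw [stereoInv_eq_snoc, smul_snoc, smul_smul, norm_smul, mul_pow, Real.norm_eq_abs, sq_abs, ha]
    congr 1
    · congr 1
      field_simp
    · field_simp
  calc ∫⁻ x : EuclideanSpace ℝ (Fin d), ∫⁻ t : ℝ, G (radial (snoc x t)) *
        ENNReal.ofReal (Real.exp (-‖snoc x t‖))
      = ∫⁻ x : EuclideanSpace ℝ (Fin d), ∫⁻ ρ in Set.Ioi (0 : ℝ),
          ENNReal.ofReal ((‖x‖ ^ 2 / ρ ^ 2 + 1) / 2) *
          (G (radial (snoc x ((‖x‖ ^ 2 / ρ - ρ) / 2))) *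
            ENNReal.ofReal (Real.exp (-‖snoc x ((‖x‖ ^ 2 / ρ - ρ) / 2)‖))) := by
        refine lintegral_congr_ae ?_
        -- The substitution needs `‖x‖ > 0`; the origin is null because `d ≥ 1`.
        filter_upwards [Measure.ae_ne volume (0 : EuclideanSpace ℝ (Fin d))] with x hx
        exact lintegral_real_eq_lintegral_Ioi (norm_pos_iff.2 hx) _
    _ = ∫⁻ ρ in Set.Ioi (0 : ℝ), ∫⁻ x : EuclideanSpace ℝ (Fin d),
          ENNReal.ofReal ((‖x‖ ^ 2 / ρ ^ 2 + 1) / 2) *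
          (G (radial (snoc x ((‖x‖ ^ 2 / ρ - ρ) / 2))) *
            ENNReal.ofReal (Real.exp (-‖snoc x ((‖x‖ ^ 2 / ρ - ρ) / 2)‖))) :=
        lintegral_lintegral_swap (by unfold Function.uncurry; fun_prop)
    _ = ∫⁻ ρ in Set.Ioi (0 : ℝ), ∫⁻ x : EuclideanSpace ℝ (Fin d),
          ENNReal.ofReal ((R ^ d)⁻¹ * a x) * G (stereoInv R x) *
            (ENNReal.ofReal (ρ ^ d) * ENNReal.ofReal (Real.exp (-(ρ * a x)))) := by
        refine setLIntegral_congr_fun measurableSet_Ioi fun ρ hρ => ?_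
        have hρ : 0 < ρ := hρ
        rw [lintegral_comp_smul (by fun_prop) (div_pos hρ hR),
          ← lintegral_const_mul _ (by fun_prop)]
        refine lintegral_congr fun x => ?_
        have hs : 0 < ρ * a x := mul_pos hρ (ha0 x)
        have hn := norm_stereoInv hR x
        have hr : radial (stereoInv R x) = stereoInv R x := by simp [radial, hn]
        rw [hpt ρ hρ.ne', radial_smul hs, hr, norm_smul (ρ * a x), hn, mul_one,
          Real.norm_of_nonneg hs.le]
        have hax : (‖(ρ / R) • x‖ ^ 2 / ρ ^ 2 + 1) / 2 = a x := by
          rw [norm_smul, mul_pow, Real.norm_eq_abs, sq_abs, ha]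
          field_simp
        rw [hax, div_pow, div_eq_inv_mul, ENNReal.ofReal_mul (by positivity),
          ENNReal.ofReal_mul (by positivity)]
        ring
    _ = ∫⁻ x : EuclideanSpace ℝ (Fin d), ∫⁻ ρ in Set.Ioi (0 : ℝ),
          ENNReal.ofReal ((R ^ d)⁻¹ * a x) * G (stereoInv R x) *
            (ENNReal.ofReal (ρ ^ d) * ENNReal.ofReal (Real.exp (-(ρ * a x)))) :=
        lintegral_lintegral_swap (by unfold Function.uncurry; fun_prop)
    _ = _ := by
        rw [← lintegral_const_mul _ (by fun_prop)]
        refine lintegral_congr fun x => ?_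
        have hax := ha0 x
        rw [lintegral_const_mul _ (by fun_prop), lintegral_pow_mul_exp_neg hax, mul_right_comm,
          ← ENNReal.ofReal_mul (by positivity), mul_left_comm (ENNReal.ofReal _) (G _),
          ← ENNReal.ofReal_mul (by positivity), mul_comm (G _)]
        congr 2
        simp only [ha, div_pow, mul_pow, pow_succ]
        have h : 0 < ‖x‖ ^ 2 + R ^ 2 := by positivity
        field_simp
        rw [one_pow, one_mul, add_comm]

end Stereographic

/-! ### Transition density of the sampler and its positivity -/

section Sampler

variable {d : ℕ} {R h : ℝ}

theorem sphereDensity_pos {t : ℝ} (ht : 0 < t) : 0 < sphereDensity d h t := by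
  rw [sphereDensity, if_pos ht]
  positivity

theorem sphereDensity_nonneg (t : ℝ) : 0 ≤ sphereDensity d h t := by
  rw [sphereDensity]
  split_ifs <;> positivity

theorem sphereConst_pos (hh : 0 < h) : 0 < sphereConst d h := by
  unfold sphereConst
  positivity

/-- Only `t → 0⁺` is delicate. With `x = t⁻²`, the singular factor `s = t⁻⁽ᵈ⁺¹⁾` satisfies `s ≤ 1 +
s² = 1 + x ^ (d+1)`, and the exponential beats this power through `y ^ k / k! ≤ exp y`. -/
theorem exists_sphereDensity_le (d : ℕ) (hh : 0 < h) : ∃ M, ∀ t, sphereDensity d h t ≤ M := by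
  refine ⟨Real.exp (1 / (2 * h ^ 2)) * (1 + (d + 1)! * (2 * h ^ 2) ^ (d + 1)), fun t => ?_⟩
  rw [sphereDensity]
  split_ifs with ht
  · set x := (t ^ 2)⁻¹ with hx
    have hx0 : 0 ≤ x := by positivity
    have h1 : (t ^ (d + 1))⁻¹ ≤ 1 + x ^ (d + 1) := by
      have h2 : x ^ (d + 1) = ((t ^ (d + 1))⁻¹) ^ 2 := by
        rw [hx, inv_pow, inv_pow, ← pow_mul, ← pow_mul, mul_comm]
      rw [h2]
      nlinarith [sq_nonneg ((t ^ (d + 1))⁻¹ - 1), sq_nonneg ((t ^ (d + 1))⁻¹)]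
    have h3 : Real.exp (-(x - 1) / (2 * h ^ 2))
        = Real.exp (1 / (2 * h ^ 2)) * (Real.exp (x / (2 * h ^ 2)))⁻¹ := by
      rw [← Real.exp_neg, ← Real.exp_add]
      congr 1
      ring
    have h4 : x ^ (d + 1) * (Real.exp (x / (2 * h ^ 2)))⁻¹ ≤ (d + 1)! * (2 * h ^ 2) ^ (d + 1) := by
      have h5 := Real.pow_div_factorial_le_exp (x / (2 * h ^ 2)) (by positivity) (d + 1)
      rw [div_pow] at h5
      rw [mul_inv_le_iff₀ (Real.exp_pos _)]
      rw [div_div, div_le_iff₀ (by positivity)] at h5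
      linarith
    have h6 : (Real.exp (x / (2 * h ^ 2)))⁻¹ ≤ 1 :=
      inv_le_one_of_one_le₀ (Real.one_le_exp (by positivity))
    rw [h3, mul_left_comm]
    refine mul_le_mul_of_nonneg_left ?_ (Real.exp_pos _).le
    refine (mul_le_mul_of_nonneg_right h1 (inv_nonneg.2 (Real.exp_pos _).le)).trans ?_
    rw [add_mul, one_mul]
    exact add_le_add h6 h4
  · positivity

/-- The density of the proposal from `x`, relative to `(R² + ‖y‖²)⁻ᵈ dy`. -/
noncomputable def proposalDensity (R h : ℝ) (x y : EuclideanSpace ℝ (Fin d)) : ℝ :=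
  sphereConst d h * (d ! * (2 * R) ^ d) *
    sphereDensity d h (inner ℝ (stereoInv R x) (stereoInv R y))

theorem proposalDensity_comm (x y : EuclideanSpace ℝ (Fin d)) :
    proposalDensity R h x y = proposalDensity R h y x := by
  rw [proposalDensity, proposalDensity, real_inner_comm]

theorem measurable_proposalDensity :
    Measurable fun q : EuclideanSpace ℝ (Fin d) × EuclideanSpace ℝ (Fin d) =>
      proposalDensity R h q.1 q.2 := by
  have hsi := measurable_stereoInv (d := d) R
  unfold proposalDensity
  fun_prop

theorem lintegral_proposal (hd : 1 ≤ d) (hR : 0 < R) (hh : 0 < h) (x : EuclideanSpace ℝ (Fin d))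
    {F : EuclideanSpace ℝ (Fin d) → ℝ≥0∞} (hF : Measurable F) :
    ∫⁻ w, F (proposal R x w) ∂(noise (d + 1) h)
      = ∫⁻ y, F y * ENNReal.ofReal (proposalDensity R h x y * ((R ^ 2 + ‖y‖ ^ 2) ^ d)⁻¹) := by
  have hs := measurable_stereo (d := d) R
  have hsi := measurable_stereoInv (d := d) R
  have h1 := lintegral_sphereMove hh (norm_stereoInv hR x) (hF.comp hs)
  have h2 := lintegral_radial_eq_lintegral_stereoInv hd hR (G := fun u => F (stereo R u) *
    ENNReal.ofReal (sphereDensity d h (inner ℝ (stereoInv R x) u))) (by fun_prop)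
  simp only [stereo_stereoInv hR] at h2
  simp only [Function.comp_apply] at h1
  have hC := sphereConst_pos (d := d) hh
  have hm := (measurable_proposalDensity (R := R) (h := h)).comp
    (measurable_prodMk_left (x := x))
  simp only [proposal]
  rw [h1, h2, ← mul_assoc, ← ENNReal.ofReal_mul hC.le, ← lintegral_const_mul _ (by fun_prop)]
  refine lintegral_congr fun y => ?_
  have h0 := sphereDensity_nonneg (d := d) (h := h) (inner ℝ (stereoInv R x) (stereoInv R y))
  rw [proposalDensity, mul_assoc (_ * _) (sphereDensity d h _),
    ENNReal.ofReal_mul (p := sphereConst d h * (d ! * (2 * R) ^ d)) (by positivity),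
    ENNReal.ofReal_mul h0]
  ring

variable {p : EuclideanSpace ℝ (Fin d) → ℝ}

/-- The density of accepted moves relative to the target distribution. -/
noncomputable def moveDensity (p : EuclideanSpace ℝ (Fin d) → ℝ) (R h : ℝ)
    (x y : EuclideanSpace ℝ (Fin d)) : ℝ :=
  proposalDensity R h x y *
    min (p x * (R ^ 2 + ‖x‖ ^ 2) ^ d)⁻¹ (p y * (R ^ 2 + ‖y‖ ^ 2) ^ d)⁻¹

theorem moveDensity_comm (x y : EuclideanSpace ℝ (Fin d)) :
    moveDensity p R h x y = moveDensity p R h y x := by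
  rw [moveDensity, moveDensity, proposalDensity_comm, min_comm]

theorem measurable_moveDensity (hp : Measurable p) :
    Measurable fun q : EuclideanSpace ℝ (Fin d) × EuclideanSpace ℝ (Fin d) =>
      moveDensity p R h q.1 q.2 := by
  have := measurable_proposalDensity (d := d) (R := R) (h := h)
  unfold moveDensity
  fun_prop

/-- Writing `b x = p x * (R² + ‖x‖²) ^ d`, this is `min 1 (b y / b x) = b y * min (b x)⁻¹ (b y)⁻¹`:
the Metropolis ratio leaves a symmetric density relative to the target. -/
theorem acceptProb_mul_eq (hR : 0 < R) (hpos : ∀ x, 0 < p x) (x y : EuclideanSpace ℝ (Fin d)) :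
    acceptProb p R x y * (proposalDensity R h x y * ((R ^ 2 + ‖y‖ ^ 2) ^ d)⁻¹)
      = p y * moveDensity p R h x y := by
  have hx : 0 < p x * (R ^ 2 + ‖x‖ ^ 2) ^ d := mul_pos (hpos x) (by positivity)
  have hM : 0 < (R ^ 2 + ‖y‖ ^ 2) ^ d := by positivity
  have hy : 0 < p y * (R ^ 2 + ‖y‖ ^ 2) ^ d := mul_pos (hpos y) hM
  have h1 : acceptProb p R x y = p y * (R ^ 2 + ‖y‖ ^ 2) ^ d *
      min (p x * (R ^ 2 + ‖x‖ ^ 2) ^ d)⁻¹ (p y * (R ^ 2 + ‖y‖ ^ 2) ^ d)⁻¹ := by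
    rw [mul_min_of_nonneg _ _ hy.le, mul_inv_cancel₀ hy.ne', min_comm, ← div_eq_mul_inv]
    rfl
  rw [h1, moveDensity]
  field_simp

theorem acceptProb_le_one (x y : EuclideanSpace ℝ (Fin d)) : acceptProb p R x y ≤ 1 :=
  min_le_left _ _

theorem acceptProb_nonneg (hpos : ∀ x, 0 < p x) (x y : EuclideanSpace ℝ (Fin d)) :
    0 ≤ acceptProb p R x y := by
  have := hpos x
  have := hpos y
  unfold acceptProb
  positivity

instance isProbabilityMeasure_noise (n : ℕ) (h : ℝ) : IsProbabilityMeasure (noise n h) :=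
  Measure.isProbabilityMeasure_map (measurable_const_smul h).aemeasurable

theorem kernel_apply (hp : Measurable p) (x : EuclideanSpace ℝ (Fin d))
    {s : Set (EuclideanSpace ℝ (Fin d))} (hs : MeasurableSet s) :
    kernel hp R h x s = ∫⁻ w, acceptReject p R x w s ∂(noise (d + 1) h) :=
  Measure.bind_apply hs (measurable_acceptReject_right hp R x).aemeasurable

theorem isMarkovKernel_kernel (hp : Measurable p) : IsMarkovKernel (kernel hp R h) := by
  refine ⟨fun x => ⟨?_⟩⟩
  rw [kernel_apply hp x MeasurableSet.univ]
  have h1 : ∀ w, acceptReject p R x w Set.univ = 1 := fun w => by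
    simp only [acceptReject, Measure.add_apply, Measure.smul_apply, measure_univ, smul_eq_mul,
      mul_one]
    exact add_tsub_cancel_of_le (ENNReal.ofReal_le_one.2 (acceptProb_le_one _ _))
  simp [h1]

/-- The target distribution. -/
noncomputable def target (p : EuclideanSpace ℝ (Fin d) → ℝ) : Measure (EuclideanSpace ℝ (Fin d)) :=
  volume.withDensity fun x => ENNReal.ofReal (p x)

/-- Accepted moves give the density part; the total rejection probability is the mass of the atom at
`x`. -/
theorem kernel_eq (hd : 1 ≤ d) (hR : 0 < R) (hh : 0 < h) (hpos : ∀ x, 0 < p x)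
    (hp : Measurable p) (x : EuclideanSpace ℝ (Fin d)) :
    kernel hp R h x = (target p).withDensity (fun y => ENNReal.ofReal (moveDensity p R h x y))
      + (∫⁻ w, (1 - ENNReal.ofReal (acceptProb p R x (proposal R x w))) ∂(noise (d + 1) h)) •
        Measure.dirac x := by
  have hmd : Measurable (moveDensity p R h x) := (measurable_moveDensity hp).of_uncurry_left
  have hprop : Measurable (proposal R x) := (measurable_proposal R).of_uncurry_left
  have hacc : Measurable (acceptProb p R x) := by unfold acceptProb; fun_prop
  ext s hs
  rw [kernel_apply hp x hs, Measure.add_apply, withDensity_apply _ hs, Measure.smul_apply,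
    smul_eq_mul, Measure.dirac_apply' _ hs]
  simp only [acceptReject, Measure.add_apply, Measure.smul_apply, smul_eq_mul,
    Measure.dirac_apply' _ hs]
  have hone : Measurable (s.indicator (1 : EuclideanSpace ℝ (Fin d) → ℝ≥0∞)) :=
    measurable_one.indicator hs
  rw [lintegral_add_left (by fun_prop), lintegral_mul_const _ (by fun_prop)]
  congr 1
  rw [lintegral_proposal hd hR hh x (F := fun y => ENNReal.ofReal (acceptProb p R x y) *
    s.indicator 1 y) (by fun_prop), ← lintegral_indicator hs, target,
    lintegral_withDensity_eq_lintegral_mul _ (by fun_prop)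
      ((by fun_prop : Measurable fun y => ENNReal.ofReal (moveDensity p R h x y)).indicator hs)]
  refine lintegral_congr fun y => ?_
  by_cases hy : y ∈ s
  · simp only [Pi.mul_apply, Set.indicator_of_mem hy, Pi.one_apply, mul_one]
    rw [← ENNReal.ofReal_mul (acceptProb_nonneg hpos x y), ← ENNReal.ofReal_mul (hpos y).le,
      acceptProb_mul_eq hR hpos]
  · simp [hy]

theorem exists_moveDensity_le (hR : 0 < R) (hh : 0 < h) (hpos : ∀ x, 0 < p x)
    (x : EuclideanSpace ℝ (Fin d)) : ∃ M, ∀ y, moveDensity p R h x y ≤ M := by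
  obtain ⟨M, hM⟩ := exists_sphereDensity_le d hh
  have hC := sphereConst_pos (d := d) hh
  have hx : 0 < p x * (R ^ 2 + ‖x‖ ^ 2) ^ d := mul_pos (hpos x) (by positivity)
  have hM0 : 0 ≤ M := (sphereDensity_nonneg 0).trans (hM 0)
  refine ⟨sphereConst d h * (d ! * (2 * R) ^ d) * M * (p x * (R ^ 2 + ‖x‖ ^ 2) ^ d)⁻¹, fun y => ?_⟩
  refine mul_le_mul (mul_le_mul_of_nonneg_left (hM _) (by positivity)) (min_le_left _ _) ?_
    (by positivity)
  have hy : 0 < p y * (R ^ 2 + ‖y‖ ^ 2) ^ d := mul_pos (hpos y) (by positivity)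
  positivity

theorem moveDensity_pos (hR : 0 < R) (hh : 0 < h) (hpos : ∀ x, 0 < p x)
    {x y : EuclideanSpace ℝ (Fin d)} (hxy : 0 < inner ℝ (stereoInv R x) (stereoInv R y)) :
    0 < moveDensity p R h x y := by
  have hx : 0 < p x * (R ^ 2 + ‖x‖ ^ 2) ^ d := mul_pos (hpos x) (by positivity)
  have hy : 0 < p y * (R ^ 2 + ‖y‖ ^ 2) ^ d := mul_pos (hpos y) (by positivity)
  have hC := sphereConst_pos (d := d) hh
  have hs := sphereDensity_pos (d := d) (h := h) hxy
  unfold moveDensity proposalDensity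
  positivity

/-- Almost every point of `ℝᵈ` can be reached from `x` in two moves. -/
theorem ae_two_step_pos (hd : 1 ≤ d) (hR : 0 < R) (hh : 0 < h) (hpos : ∀ x, 0 < p x)
    (hp : Measurable p) (x : EuclideanSpace ℝ (Fin d)) :
    ∀ᵐ y ∂(target p), ∫⁻ u, ENNReal.ofReal (moveDensity p R h x u) *
      ENNReal.ofReal (moveDensity p R h u y) ∂(target p) ≠ 0 := by
  have : Nonempty (Fin d) := ⟨⟨0, hd⟩⟩
  have hanti : ∀ᵐ y ∂(volume : Measure (EuclideanSpace ℝ (Fin d))),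
      stereoInv R x + stereoInv R y ≠ 0 := by
    -- Only one `y` can be sent to the antipode of `stereoInv R x`, since `stereoInv R` is
    -- injective; a point is null as `d ≥ 1`.
    have hsub : {y : EuclideanSpace ℝ (Fin d) |
        ¬ stereoInv R x + stereoInv R y ≠ 0}.Subsingleton := by
      intro y hy y' hy'
      have h1 := (not_not.1 hy).trans (not_not.1 hy').symm
      rw [← stereo_stereoInv hR y, ← stereo_stereoInv hR y', add_left_cancel h1]
    exact hsub.measure_zero _
  have hac : target p ≪ volume := withDensity_absolutelyContinuous _ _
  filter_upwards [hac.ae_le hanti] with y hy h0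
  have hmd : Measurable (moveDensity p R h x) := (measurable_moveDensity hp).of_uncurry_left
  have hmd' : Measurable fun u => moveDensity p R h u y :=
    (measurable_moveDensity hp).of_uncurry_right
  rw [lintegral_eq_zero_iff (by fun_prop)] at h0
  have hac' : (volume : Measure (EuclideanSpace ℝ (Fin d))) ≪ target p :=
    withDensity_absolutelyContinuous' (by fun_prop)
      (ae_of_all _ fun u => (ENNReal.ofReal_pos.2 (hpos u)).ne')
  set U : Set (EuclideanSpace ℝ (Fin (d + 1))) :=
    {u | 0 < inner ℝ (stereoInv R x) u ∧ 0 < inner ℝ u (stereoInv R y)} with hU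
  have hc1 : Continuous fun u => inner ℝ (stereoInv R x) u := by fun_prop
  have hc2 : Continuous fun u => inner ℝ u (stereoInv R y) := by fun_prop
  have hUo : IsOpen U :=
    (isOpen_lt continuous_const hc1).inter (isOpen_lt continuous_const hc2)
  -- Points reachable in one move from both ends correspond to `U`. If they were null in `ℝᵈ`, the
  -- directions in `U` would be null in `ℝ^(d+1)`.
  have h2 := lintegral_radial_eq_lintegral_stereoInv hd hR (G := U.indicator 1)
    (measurable_one.indicator hUo.measurableSet)
  have h3 : ∫⁻ u : EuclideanSpace ℝ (Fin d), U.indicator 1 (stereoInv R u) *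
      ENNReal.ofReal (((R ^ 2 + ‖u‖ ^ 2) ^ d)⁻¹) = 0 := by
    rw [← lintegral_zero (μ := (volume : Measure (EuclideanSpace ℝ (Fin d))))]
    refine lintegral_congr_ae ?_
    filter_upwards [hac'.ae_le h0] with u hu
    have : stereoInv R u ∉ U := fun hmem => by
      have h4 := moveDensity_pos hR hh hpos hmem.1
      have h5 := moveDensity_pos hR hh hpos hmem.2
      exact mul_ne_zero (ENNReal.ofReal_pos.2 h4).ne' (ENNReal.ofReal_pos.2 h5).ne' hu
    simp [this]
  have hUm : Measurable (U.indicator (1 : EuclideanSpace ℝ (Fin (d + 1)) → ℝ≥0∞)) :=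
    measurable_one.indicator hUo.measurableSet
  rw [h3, mul_zero, lintegral_eq_zero_iff (by fun_prop)] at h2
  have hUne : U.Nonempty := by
    refine ⟨stereoInv R x + stereoInv R y, ?_⟩
    -- For unit vectors, `‖z + z'‖² = 2 (1 + ⟨z, z'⟩)`, so `z + z'` has positive inner product with
    -- both.
    have h6 : 0 < ‖stereoInv R x + stereoInv R y‖ ^ 2 := by
      have := norm_pos_iff.2 hy
      positivity
    rw [norm_add_sq_real, norm_stereoInv hR, norm_stereoInv hR] at h6
    constructor
    · rw [inner_add_right, real_inner_self_eq_norm_sq, norm_stereoInv hR]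
      linarith
    · rw [inner_add_left, real_inner_self_eq_norm_sq, norm_stereoInv hR]
      linarith
  -- `U` is a nonempty open cone: a point and its direction lie in it together, so the integrand in
  -- `h2` is positive on all of `U`.
  refine (hUo.measure_pos volume hUne).ne' (measure_mono_null ?_ h2)
  intro u hu hu0
  have hu1 : 0 < ‖u‖ := by
    rw [norm_pos_iff]
    rintro rfl
    simpa using hu.1
  have hmem : radial u ∈ U := by
    have h7 := inv_pos.2 hu1
    constructor
    · rw [radial, real_inner_smul_right]
      exact mul_pos h7 hu.1
    · rw [radial, real_inner_smul_left]
      exact mul_pos h7 hu.2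
  change U.indicator 1 (radial u) * ENNReal.ofReal (Real.exp (-‖u‖)) = 0 at hu0
  rw [Set.indicator_of_mem hmem, Pi.one_apply, one_mul, ENNReal.ofReal_eq_zero] at hu0
  exact (Real.exp_pos _).not_ge hu0

end Sampler

end SPS

theorem mainTheorem2 (d : ℕ) (hd : 1 ≤ d) (R h : ℝ) (hR : 0 < R) (hh : 0 < h)
    (p : EuclideanSpace ℝ (Fin d) → ℝ) (hpos : ∀ x, 0 < p x) (hcont : Continuous p)
    (hint : ∫⁻ x, ENNReal.ofReal (p x) = 1) :
    SPS.IsErgodicWith (SPS.kernel hcont.measurable R h)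
      (volume.withDensity fun x => ENNReal.ofReal (p x)) := by
  have hp := hcont.measurable
  have := SPS.isMarkovKernel_kernel (R := R) (h := h) hp
  have : IsProbabilityMeasure (volume.withDensity fun x => ENNReal.ofReal (p x)) :=
    ⟨by rw [withDensity_apply _ MeasurableSet.univ, Measure.restrict_univ, hint]⟩
  refine SPS.IsErgodicWith.of_density
    (D := fun x y => ENNReal.ofReal (SPS.moveDensity p R h x y))
    (SPS.measurable_moveDensity hp).ennreal_ofReal
    (fun x y => by rw [SPS.moveDensity_comm]) (SPS.kernel_eq hd hR hh hpos hp) (fun x => ?_)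
    (SPS.ae_two_step_pos hd hR hh hpos hp)
  obtain ⟨M, hM⟩ := SPS.exists_moveDensity_le hR hh hpos x
  exact ⟨M, fun y => ENNReal.ofReal_le_ofReal (hM y)⟩
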